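/- For a finite set $A\subset\mathbb{Z}^3$, every $\alpha\in\mathbb{R}^A$ induces a regular subdivision $\mathcal{S}_\alpha$ of $\operatorname{conv}(A)$, whose cells are the projections of the top faces of $\operatorname{conv}\{(a,\alpha(a)) : a\in A\}\subset\mathbb{R}^3\times\mathbb{R}$ (together with $\emptyset$). The secondary fan $\Phi(A)$ is the set of closed cones in $\mathbb{R}^A$ that are the closures of the sets of all $\alpha$ inducing one fixed (marked) regular subdivision; here the marking of $\mathcal{S}_\alpha$ records, for each cell, the points of $A$ whose lifts $(a,\alpha(a))$ lie on the corresponding top face. For an integer $\delta\ge 1$ let $\Gamma_\delta=\operatorname{conv}\{(0,0,0),(\delta,0,0),(0,\delta,0),(0,0,\delta)\}$, $A_\delta=\Gamma_\delta\cap\mathbb{Z}^3$ and $\Phi(\Gamma_\delta)=\Phi(A_\delta)$. A subdivision of $\Gamma_\delta$ into lattice polytopes is an elementary triangulation if all its maximal cells are tetrahedra of volume $\tfrac16$. A tropical polynomial $f(x)=\max_{a\in A}(\lambda_a+\langle a,x\rangle)$ with Newton polytope $\operatorname{conv}(A)=\Gamma_\delta$ defines the tropical surface $V_{tr}(f)\subset\mathbb{R}^3$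 of degree $\delta$, the set of points $x$ at which the maximum is attained at least twice; it is smooth if the subdivision of $\Gamma_\delta$ induced by $a\mapsto\lambda_a$ is an elementary triangulation. For $\alpha\in\mathbb{R}^{A_\delta}$ put $f_\alpha(x)=\max_{a\in A_\delta}(\alpha(a)+\langle a,x\rangle)$. Let $\omega_1=-e_1$, $\omega_2=-e_2$, $\omega_3=-e_3$, $\omega_4=e_1+e_2+e_3$. A tropical line in $\mathbb{R}^3$ is a set consisting of a segment $[v,w]$ with $w=v-t(\omega_i+\omega_j)$, $t\ge 0$, together with the rays from $v$ in the directions $\omega_i,\omega_j$ and the rays from $w$ in the directions $\omega_k,\omega_l$, where $\{i,j,k,l\}=\{1,2,3,4\}$. A two-point family on a tropical surface $X$ is an infinite collection of tropical lines contained in $X$ for which there are two distinct points lying on all lines of the collection. Theorem. For every integer $\delta\ge 1$ there is a regular elementary triangulation $\mathcal{S}$ of $\Gamma_\delta$ which contains the tetrahedron $$\Omega_\delta=\operatorname{conv}\{(0,0,0),(0,0,1),(\delta-1,1,0),(1,0,\delta-1)\},$$ and there is a full-dimensional polyhedral cone $\sigma\in\Phi(\Gamma_\delta)$ whose interior is the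 (nonempty) set of all $\alpha\in\mathbb{R}^{A_\delta}$ with $\mathcal{S}_\alpha=\mathcal{S}$, such that for every $\alpha$ in the interior of $\sigma$ the surface $V_{tr}(f_\alpha)$ is a smooth tropical surface of degree $\delta$ and there is a two-point family of tropical lines on it. In particular, for every $\delta\ge 1$ there exists a smooth tropical surface of degree $\delta$ that contains infinitely many tropical lines. -/

import Mathlib

namespace TropicalLines

open MeasureTheory

/-! ### Lattice polytopes and subdivisions -/

/-- A convex polytope in `ℝⁿ` (possibly empty): the convex hull of a finite set. -/
def IsPolytope {n : ℕ} (C : Set (Fin n → ℝ)) : Prop :=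
  ∃ V : Finset (Fin n → ℝ), C = convexHull ℝ (V : Set (Fin n → ℝ))

/-- A lattice polytope in `ℝⁿ`: the convex hull of finitely many points of `ℤⁿ`. -/
def IsLatticePolytope {n : ℕ} (C : Set (Fin n → ℝ)) : Prop :=
  ∃ V : Finset (Fin n → ℤ),
    C = convexHull ℝ ((fun (v : Fin n → ℤ) (i : Fin n) => (v i : ℝ)) '' (V : Set (Fin n → ℤ)))

/-- A simplex: the convex hull of (finitely many, at least one) affinely independent points. -/
def IsSimplex {n : ℕ} (C : Set (Fin n → ℝ)) : Prop :=
  ∃ (k : ℕ) (p : Fin (k + 1) → (Fin n → ℝ)),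
    AffineIndependent ℝ p ∧ C = convexHull ℝ (Set.range p)

/-- An elementary (unimodular) polytope in `ℝⁿ`: an `n`-dimensional lattice polytope of
volume `1 / n!`. -/
def IsElementary {n : ℕ} (C : Set (Fin n → ℝ)) : Prop :=
  IsLatticePolytope C ∧ affineSpan ℝ C = ⊤ ∧ volume C = (n.factorial : ENNReal)⁻¹

/-- A subdivision of the polytope `Δ`: a finite polyhedral complex whose cells have union `Δ`
(so that all cells are polytopes). Faces are exposed faces; both `∅` and the cell itself count as
faces. -/
structure IsSubdivision {n : ℕ} (Δ : Set (Fin n → ℝ)) (S : Set (Set (Fin n → ℝ))) : Prop where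
  finite : S.Finite
  polytope : ∀ C ∈ S, IsPolytope C
  face_mem : ∀ C ∈ S, ∀ F, IsExposed ℝ C F → F ∈ S
  inter_face : ∀ C ∈ S, ∀ C' ∈ S, IsExposed ℝ C (C ∩ C') ∧ IsExposed ℝ C' (C ∩ C')
  union_eq : ⋃₀ S = Δ

/-- An elementary triangulation of `Δ`: a subdivision into lattice polytopes, all of whose maximal
cells are elementary simplices. -/
structure IsElementaryTriangulation {n : ℕ} (Δ : Set (Fin n → ℝ))
    (S : Set (Set (Fin n → ℝ))) : Prop where
  subdivision : IsSubdivision Δ S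
  lattice : ∀ C ∈ S, IsLatticePolytope C
  simplex : ∀ C, Maximal (· ∈ S) C → IsSimplex C
  elementary : ∀ C, Maximal (· ∈ S) C → IsElementary C

/-! ### Regular subdivisions and the secondary fan -/

/-- An exponent vector, regarded as a point of `ℝⁿ`. -/
def toReal {n : ℕ} (a : Fin n → ℕ) : Fin n → ℝ := fun i => (a i : ℝ)

/-- The convex hull in `ℝⁿ × ℝ` of the points `(a, α a)`, `a ∈ A`. -/
def liftedPolytope {n : ℕ} (A : Finset (Fin n → ℕ)) (α : A → ℝ) : Set ((Fin n → ℝ) × ℝ) :=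
  convexHull ℝ (Set.range fun a : A => (toReal a.1, α a))

/-- `F` is a (nonempty) top face of `P`: the set of points of `P` that maximise a linear functional
whose coefficient at the last coordinate is positive (normalised to `1`). -/
def IsTopFace {n : ℕ} (P F : Set ((Fin n → ℝ) × ℝ)) : Prop :=
  ∃ u : Fin n → ℝ, F = {p ∈ P | ∀ q ∈ P, u ⬝ᵥ q.1 + q.2 ≤ u ⬝ᵥ p.1 + p.2}

/-- The subdivision of `conv A` induced by the lifting function `α`: the projections to `ℝⁿ` of the
top faces of the lifted polytope, together with the empty cell. -/
def inducedSubdivision {n : ℕ} (A : Finset (Fin n → ℕ)) (α : A → ℝ) :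
    Set (Set (Fin n → ℝ)) :=
  insert ∅ {C | ∃ F, IsTopFace (liftedPolytope A α) F ∧ C = Prod.fst '' F}

/-- `S` is a regular subdivision of `conv A`. -/
def IsRegularSubdivision {n : ℕ} (A : Finset (Fin n → ℕ)) (S : Set (Set (Fin n → ℝ))) : Prop :=
  ∃ α : A → ℝ, S = inducedSubdivision A α

/-- The set `K(S)` of all lifting functions in `ℝ^A` that induce `S`. -/
def inducingLifts {n : ℕ} (A : Finset (Fin n → ℕ)) (S : Set (Set (Fin n → ℝ))) : Set (A → ℝ) :=
  {α | inducedSubdivision A α = S}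

/-- The marked version of the subdivision induced by `α`: for every nonempty cell, the set of those
points of `A` whose lifts lie on the corresponding top face. It is the marked subdivision that
labels the cones of the secondary fan (it remembers which non-vertices are lifted onto a face). -/
def markedSubdivision {n : ℕ} (A : Finset (Fin n → ℕ)) (α : A → ℝ) : Set (Set A) :=
  {M | ∃ u : Fin n → ℝ,
    M = {a : A | ∀ b : A, u ⬝ᵥ toReal b.1 + α b ≤ u ⬝ᵥ toReal a.1 + α a}}

/-- The secondary fan of `A`, a set of closed cones in `ℝ^A`: each cone is the closure of the set of
all lifting functions that induce one given marked regular subdivision. -/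
def secondaryFan {n : ℕ} (A : Finset (Fin n → ℕ)) : Set (Set (A → ℝ)) :=
  {σ | ∃ α : A → ℝ, σ = closure {β : A → ℝ | markedSubdivision A β = markedSubdivision A α}}

/-- A (polyhedral) cone: an intersection of finitely many closed half-spaces bounded by hyperplanes
through the origin. -/
def IsPolyhedralCone {V : Type*} [AddCommGroup V] [Module ℝ V] (σ : Set V) : Prop :=
  ∃ H : Finset (Module.Dual ℝ V), σ = {v | ∀ l ∈ H, 0 ≤ l v}

/-! ### Tropical hypersurfaces -/

/-- A tropical polynomial `max_{a ∈ A} (λ_a + ⟨a, x⟩)` over `(ℝ, max, +)`, with support `A` and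
coefficients `λ`. -/
structure TropicalPolynomial (n : ℕ) where
  support : Finset (Fin n → ℕ)
  coeff : support → ℝ

namespace TropicalPolynomial

/-- The value at `x` of the monomial of `f` with exponent `a`. -/
def term {n : ℕ} (f : TropicalPolynomial n) (a : f.support) (x : Fin n → ℝ) : ℝ :=
  f.coeff a + toReal a.1 ⬝ᵥ x

/-- The tropical hypersurface of `f`: the points where the maximum of the monomials is attained at
least twice. -/
def hypersurface {n : ℕ} (f : TropicalPolynomial n) : Set (Fin n → ℝ) :=
  {x | ∃ a b : f.support, a ≠ b ∧
    (∀ c, f.term c x ≤ f.term a x) ∧ (∀ c, f.term c x ≤ f.term b x)}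

/-- The Newton polytope of `f`. -/
def newtonPolytope {n : ℕ} (f : TropicalPolynomial n) : Set (Fin n → ℝ) :=
  convexHull ℝ (toReal '' (f.support : Set (Fin n → ℕ)))

/-- The subdivision of the Newton polytope induced by the coefficients of `f`. -/
def subdiv {n : ℕ} (f : TropicalPolynomial n) : Set (Set (Fin n → ℝ)) :=
  inducedSubdivision f.support f.coeff

end TropicalPolynomial

/-- The simplex `Γ_δ` in `ℝ³`. -/
def Gam (δ : ℕ) : Set (Fin 3 → ℝ) :=
  convexHull ℝ {![0, 0, 0], ![(δ : ℝ), 0, 0], ![0, (δ : ℝ), 0], ![0, 0, (δ : ℝ)]}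

/-- The lattice points of `Γ_δ`, i.e. the `a ∈ ℕ³` with `a₁ + a₂ + a₃ ≤ δ`. -/
def gamPoints (δ : ℕ) : Finset (Fin 3 → ℕ) :=
  (Fintype.piFinset fun _ : Fin 3 => Finset.range (δ + 1)).filter fun a => a 0 + a 1 + a 2 ≤ δ

/-- The tropical polynomial with a coefficient `α a` at every lattice point `a` of `Γ_δ`. -/
def polyOfLift (δ : ℕ) (α : gamPoints δ → ℝ) : TropicalPolynomial 3 where
  support := gamPoints δ
  coeff := α

/-- `f` defines a smooth tropical surface of degree `δ`: its Newton polytope is `Γ_δ`, and the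
subdivision it induces is an elementary triangulation of `Γ_δ`. -/
def DefinesSmoothSurface (δ : ℕ) (f : TropicalPolynomial 3) : Prop :=
  f.newtonPolytope = Gam δ ∧ IsElementaryTriangulation (Gam δ) f.subdiv

/-- `X` is a smooth tropical surface of degree `δ`. -/
def IsSmoothTropicalSurface (δ : ℕ) (X : Set (Fin 3 → ℝ)) : Prop :=
  ∃ f : TropicalPolynomial 3, X = f.hypersurface ∧ DefinesSmoothSurface δ f

/-- The tetrahedron `Ω_δ`. -/
def Omeg (δ : ℕ) : Set (Fin 3 → ℝ) :=
  convexHull ℝ {![0, 0, 0], ![0, 0, 1], ![(δ : ℝ) - 1, 1, 0], ![1, 0, (δ : ℝ) - 1]}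

/-! ### Tropical lines in `ℝ³` -/

/-- The directions `-e₁, -e₂, -e₃, e₁ + e₂ + e₃`. -/
def omega : Fin 4 → (Fin 3 → ℝ) :=
  ![![-1, 0, 0], ![0, -1, 0], ![0, 0, -1], ![1, 1, 1]]

/-- The unbounded ray from `p` in the direction `omega i`. -/
def ray (p : Fin 3 → ℝ) (i : Fin 4) : Set (Fin 3 → ℝ) :=
  {x | ∃ s : ℝ, 0 ≤ s ∧ x = p + s • omega i}

/-- `L` is a tropical line in `ℝ³`: it has vertices `v` and `w` joined by a bounded edge, two of the
four rays start at `v` and the other two at `w`, and `L` is balanced at both vertices, where `d` is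
the outgoing direction of the bounded edge at `v` (the balancing equation forces the coordinates
of `d` to be `0`, `1` or `-1`, not all `0`, so `d` is a primitive integer vector). The case `t = 0`
is that of a degenerate tropical line. -/
def IsTropicalLine (L : Set (Fin 3 → ℝ)) : Prop :=
  ∃ (i : Equiv.Perm (Fin 4)) (v w d : Fin 3 → ℝ) (t : ℝ), 0 ≤ t ∧ w = v + t • d ∧
    omega (i 0) + omega (i 1) + d = 0 ∧ omega (i 2) + omega (i 3) + -d = 0 ∧
    L = segment ℝ v w ∪ (ray v (i 0) ∪ ray v (i 1)) ∪ (ray w (i 2) ∪ ray w (i 3))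

/-- A two-point family: an infinite collection of tropical lines all of which pass through two
common (distinct) points. -/
def IsTwoPointFamily (𝓕 : Set (Set (Fin 3 → ℝ))) : Prop :=
  𝓕.Infinite ∧ (∀ L ∈ 𝓕, IsTropicalLine L) ∧
    ∃ P Q : Fin 3 → ℝ, P ≠ Q ∧ ∀ L ∈ 𝓕, P ∈ L ∧ Q ∈ L

/-- A two-point family on `X`: all its tropical lines are contained in `X`. -/
def IsTwoPointFamilyOn (X : Set (Fin 3 → ℝ)) (𝓕 : Set (Set (Fin 3 → ℝ))) : Prop :=
  IsTwoPointFamily 𝓕 ∧ ∀ L ∈ 𝓕, L ⊆ X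

end TropicalLines

/-! Suppose Ω_δ is a cell of the induced subdivision, and let `u` be the dual vertex of the surface,
where the four monomials of Ω_δ tie for the maximum. The edge from (0,0,0) to (0,0,1) lies on an
edge of Γ_δ, and its two monomials stay maximal on the whole quadrant u - pe₁ - qe₂ with p, q ≥ 0.
The points (0,0,0) and (δ-1,1,0) lie on the facet a₃ = 0, so the ray from `u` along -e₃ is in the
surface. The points (δ-1,1,0) and (1,0,δ-1) lie on the facet a₁+a₂+a₃ = δ, so the ray along e₁+e₂+e₃
is too. Hence every tropical line with these two rays at `u` and its second vertex at u - t(e₁+e₂)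
is contained in the surface, and all of them contain `u` and u - e₃
(`pencilLine_subset_hypersurface`).

It remains to build a regular unimodular triangulation containing Ω_δ. This is done by raising the
dimension one coordinate at a time (`IsCornerTriangulation.fibre`). Over each lattice point of the
lower-dimensional dilated simplex stands a column of lattice points. The columns are filled one
after another, and each unit step of a column sweeps out one unimodular simplex over every base
simplex having that column's foot as a vertex. A small concave perturbation of the pulled-back base
lift shows regularity. The filling order decides which simplices appear, and
`exists_cornerTriangulation` chooses it so that Ω_δ does.

For a unimodular triangulation, the lifts inducing it are cut out by finitely many strict linear
inequalities (`IsUnimodularCover.exists_duals`). They therefore form the interior of a polyhedral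
cone. Since a unimodular simplex has no lattice points except its vertices, the marked and the
unmarked subdivision determine each other here, so this cone belongs to the secondary fan. -/

namespace TropicalLines

open Filter Topology MeasureTheory

/-! ### Unimodular simplices and regular triangulations of the corner simplex -/

/-- The lattice points of the `δ`-fold dilated standard corner simplex in `ℝⁿ`. -/
def cornerPoints (n δ : ℕ) : Finset (Fin n → ℕ) :=
  (Fintype.piFinset fun _ : Fin n => Finset.range (δ + 1)).filter fun a => ∑ j, a j ≤ δ

theorem mem_cornerPoints {n δ : ℕ} {a : Fin n → ℕ} : a ∈ cornerPoints n δ ↔ ∑ j, a j ≤ δ := by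
  simp only [cornerPoints, Finset.mem_filter, Fintype.mem_piFinset, Finset.mem_range,
    and_iff_right_iff_imp]
  intro h i
  have := Finset.single_le_sum (f := a) (fun j _ => Nat.zero_le _) (Finset.mem_univ i)
  omega

/-- A set of `n + 1` lattice points is unimodular if every integral function on it extends to an
integral affine function. -/
def IsUnimodular {n : ℕ} (T : Finset (Fin n → ℕ)) : Prop :=
  T.card = n + 1 ∧ ∀ φ : (Fin n → ℕ) → ℤ, ∃ (w : Fin n → ℤ) (c : ℤ),
    ∀ t ∈ T, ∑ j, w j * (t j : ℤ) + c = φ t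

theorem IsUnimodular.exists_indicator {n : ℕ} {T : Finset (Fin n → ℕ)} (hT : IsUnimodular T)
    (s : Fin n → ℕ) : ∃ (w : Fin n → ℤ) (c : ℤ),
      ∀ t ∈ T, ∑ j, w j * (t j : ℤ) + c = if t = s then 1 else 0 :=
  hT.2 _

theorem IsUnimodular.exists_affine {n : ℕ} {T : Finset (Fin n → ℕ)} (hT : IsUnimodular T)
    (φ : (Fin n → ℕ) → ℝ) : ∃ (w : Fin n → ℝ) (c : ℝ), ∀ t ∈ T, w ⬝ᵥ toReal t + c = φ t := by
  choose w c h using hT.exists_indicator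
  refine ⟨fun j => ∑ s ∈ T, φ s * w s j, ∑ s ∈ T, φ s * c s, fun t ht => ?_⟩
  have : ∀ s, φ s * (∑ j, (w s j : ℝ) * (t j : ℝ) + c s) = if t = s then φ s else 0 := by
    intro s
    have := congrArg (Int.cast : ℤ → ℝ) (h s t ht)
    push_cast at this
    rw [this]
    split_ifs <;> simp
  calc _ = ∑ s ∈ T, φ s * (∑ j, (w s j : ℝ) * (t j : ℝ) + c s) := by
        simp only [dotProduct, toReal, Finset.sum_mul, mul_add, Finset.sum_add_distrib,
          Finset.mul_sum]
        rw [Finset.sum_comm]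
        simp only [mul_assoc]
    _ = φ t := by
        simp only [this]
        simp [ht]

/-- The lifting function `g` on `A` has a top face whose marked points are exactly those of `T`. -/
def Supports {n : ℕ} (A : Finset (Fin n → ℕ)) (g : (Fin n → ℕ) → ℝ) (T : Finset (Fin n → ℕ)) :
    Prop :=
  ∃ (u : Fin n → ℝ) (c : ℝ), ∀ a ∈ A,
    u ⬝ᵥ toReal a + g a ≤ c ∧ (u ⬝ᵥ toReal a + g a = c ↔ a ∈ T)

/-- `𝒯` is the set of vertex sets of the maximal cells of a regular unimodular triangulation of the
`δ`-fold dilated corner simplex. -/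
structure IsCornerTriangulation (n δ : ℕ) (𝒯 : Set (Finset (Fin n → ℕ))) : Prop where
  subset : ∀ T ∈ 𝒯, T ⊆ cornerPoints n δ
  unimodular : ∀ T ∈ 𝒯, IsUnimodular T
  exists_lt : ∀ T ∈ 𝒯, ∃ t ∈ T, ∑ j, t j < δ
  cover : ∀ x : Fin n → ℝ, (∀ j, 0 ≤ x j) → ∑ j, x j ≤ δ →
    ∃ T ∈ 𝒯, ∃ l : (Fin n → ℕ) → ℝ, (∀ t ∈ T, 0 ≤ l t) ∧ ∑ t ∈ T, l t = 1 ∧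
      ∀ j, ∑ t ∈ T, l t * (t j : ℝ) = x j
  regular : ∃ g : (Fin n → ℕ) → ℝ, ∀ T ∈ 𝒯, Supports (cornerPoints n δ) g T

theorem isCornerTriangulation_zero {δ : ℕ} (hδ : 0 < δ) :
    IsCornerTriangulation 0 δ {{![]}} where
  subset := by
    rintro T rfl
    simp [mem_cornerPoints]
  unimodular := by
    rintro T rfl
    exact ⟨by simp, fun φ => ⟨0, φ ![], by simp⟩⟩
  exists_lt := by
    rintro T rfl
    exact ⟨![], by simp, by simpa⟩
  cover x _ _ := ⟨_, rfl, fun _ => 1, by simp, by simp, fun j => j.elim0⟩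
  regular := ⟨0, by
    rintro T rfl
    exact ⟨0, 0, fun a _ => by simp [Subsingleton.elim a ![]]⟩⟩

/-! ### Fibred triangulations -/

/-- The level at time `k` of a column of height `m` that starts to grow at time `o`. -/
def level (o m k : ℕ) : ℕ := min (k - o) m

theorem level_eq_of_mem {o m k : ℕ} (h₁ : o ≤ k) (h₂ : k < o + m) : level o m k = k - o := by
  unfold level; omega

theorem level_succ_of_mem {o m k : ℕ} (h₁ : o ≤ k) (h₂ : k < o + m) :
    level o m (k + 1) = level o m k + 1 := by
  unfold level; omega

theorem level_succ_of_not_mem {o m k : ℕ} (h : ¬(o ≤ k ∧ k < o + m)) :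
    level o m (k + 1) = level o m k := by
  unfold level; omega

theorem level_le (o m k : ℕ) : level o m k ≤ m := min_le_right _ _

/-- The concave quadratic in z has its vertex at k - o + 1/2, so on all integers it is maximal
exactly at k - o and k - o + 1. Clipping to the range 0..m turns these into the levels at times k
and k + 1, which differ only while the column is growing. -/
theorem column_max (o m k z : ℕ) (hz : z ≤ m) :
    (z : ℝ) * (2 * (k - o) + 1 - z) ≤ level o m k * (2 * (k - o) + 1 - level o m k) ∧
    ((z : ℝ) * (2 * (k - o) + 1 - z) = level o m k * (2 * (k - o) + 1 - level o m k) ↔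
      z = level o m k ∨ z = level o m (k + 1)) := by
  suffices H : (z : ℤ) * (2 * (k - o) + 1 - z) ≤ level o m k * (2 * (k - o) + 1 - level o m k) ∧
    ((z : ℤ) * (2 * (k - o) + 1 - z) = level o m k * (2 * (k - o) + 1 - level o m k) ↔
      z = level o m k ∨ z = level o m (k + 1)) by
    exact_mod_cast H
  rcases lt_or_ge k o with h | h
  · have h1 : level o m k = 0 := by unfold level; omega
    have h2 : level o m (k + 1) = 0 := by unfold level; omega
    rw [h1, h2]
    rcases Nat.eq_zero_or_pos z with rfl | hz0
    · simp
    · have : (z : ℤ) * (2 * (k - o) + 1 - z) < 0 := by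
        apply mul_neg_of_pos_of_neg <;> omega
      simp only [Nat.cast_zero, zero_mul, or_self]
      exact ⟨this.le, fun h => absurd h this.ne, fun h => by omega⟩
  rcases lt_or_ge (k - o) m with h' | h'
  · have h1 : level o m k = k - o := by unfold level; omega
    have h2 : level o m (k + 1) = k - o + 1 := by unfold level; omega
    obtain ⟨d, rfl⟩ := Nat.exists_eq_add_of_le h
    rw [h1, h2]
    simp only [add_tsub_cancel_left, Nat.cast_add]
    have key : (d : ℤ) * (2 * (o + d - o) + 1 - d) - z * (2 * (o + d - o) + 1 - z)
        = (d - z) * (d + 1 - z) := by ring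
    have hpos : 0 ≤ ((d : ℤ) - z) * (d + 1 - z) := by
      rcases le_or_gt z d with hzd | hzd
      · apply mul_nonneg <;> omega
      · apply mul_nonneg_of_nonpos_of_nonpos <;> omega
    refine ⟨by linarith, fun he => ?_, ?_⟩
    · have : ((d : ℤ) - z) * (d + 1 - z) = 0 := by linarith
      rcases mul_eq_zero.1 this with h | h <;> omega
    · rintro (rfl | rfl)
      · rfl
      · push_cast; ring
  · have h1 : level o m k = m := by unfold level; omega
    have h2 : level o m (k + 1) = m := by unfold level; omega
    rw [h1, h2]
    have key : (m : ℤ) * (2 * (k - o) + 1 - m) - z * (2 * (k - o) + 1 - z)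
        = (m - z) * (2 * (k - o) + 1 - m - z) := by ring
    have hp : 0 < 2 * ((k : ℤ) - o) + 1 - m - z := by omega
    have hm : 0 ≤ (m : ℤ) - z := by omega
    refine ⟨by nlinarith, fun he => ?_, ?_⟩
    · have : ((m : ℤ) - z) * (2 * (k - o) + 1 - m - z) = 0 := by linarith
      rcases mul_eq_zero.1 this with h | h <;> omega
    · rintro (rfl | rfl) <;> rfl

/-- The height of the column over the lattice point `c`. -/
def colHeight {n : ℕ} (δ : ℕ) (c : Fin n → ℕ) : ℕ := δ - ∑ j, c j

/-- The level at time `k` of the column over `c`. -/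
def colLevel {n : ℕ} (δ : ℕ) (o : (Fin n → ℕ) → ℕ) (k : ℕ) (c : Fin n → ℕ) : ℕ :=
  level (o c) (colHeight δ c) k

/-- The column over `c` grows between the times `k` and `k + 1`. -/
def Moves {n : ℕ} (δ : ℕ) (o : (Fin n → ℕ) → ℕ) (k : ℕ) (c : Fin n → ℕ) : Prop :=
  o c ≤ k ∧ k < o c + colHeight δ c

/-- The vertices of the simplex over `τ` swept out between the times `k` and `k + 1`, when the
column over `i` is growing. -/
def fibreSimplex {n : ℕ} (p : Fin (n + 1)) (δ : ℕ) (o : (Fin n → ℕ) → ℕ) (k : ℕ)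
    (τ : Finset (Fin n → ℕ)) (i : Fin n → ℕ) : Finset (Fin (n + 1) → ℕ) :=
  insert (p.insertNth (colLevel δ o k i + 1) i) (τ.image fun c => p.insertNth (colLevel δ o k c) c)

/-- All simplices lying over the simplices of `𝒯`. -/
def fibreSimplices {n : ℕ} (p : Fin (n + 1)) (δ : ℕ) (o : (Fin n → ℕ) → ℕ)
    (𝒯 : Set (Finset (Fin n → ℕ))) : Set (Finset (Fin (n + 1) → ℕ)) :=
  {T | ∃ τ ∈ 𝒯, ∃ i ∈ τ, ∃ k, Moves δ o k i ∧ T = fibreSimplex p δ o k τ i}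

theorem insertNth_inj_base {n : ℕ} (p : Fin (n + 1)) {x y : ℕ} {b c : Fin n → ℕ}
    (h : (p.insertNth x b : Fin (n + 1) → ℕ) = p.insertNth y c) : x = y ∧ b = c := by
  constructor
  · simpa using congrFun h p
  · simpa using congrArg p.removeNth h

/-- A column that does not grow has equal levels at both times, so the asymmetric definition takes a
form uniform in `c`. This is the form that `column_max` produces. -/
theorem mem_fibreSimplex {n : ℕ} {p : Fin (n + 1)} {δ : ℕ} {o : (Fin n → ℕ) → ℕ} {k : ℕ}
    {τ : Finset (Fin n → ℕ)} {i : Fin n → ℕ} (hi : i ∈ τ) (hm : Moves δ o k i)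
    (huniq : ∀ c ∈ τ, Moves δ o k c → c = i) (z : ℕ) (c : Fin n → ℕ) :
    p.insertNth z c ∈ fibreSimplex p δ o k τ i ↔
      c ∈ τ ∧ (z = colLevel δ o k c ∨ z = colLevel δ o (k + 1) c) := by
  simp only [fibreSimplex, Finset.mem_insert, Finset.mem_image]
  constructor
  · rintro (h | ⟨b, hb, h⟩)
    · obtain ⟨rfl, rfl⟩ := insertNth_inj_base p h
      exact ⟨hi, Or.inr (level_succ_of_mem hm.1 hm.2).symm⟩
    · obtain ⟨rfl, rfl⟩ := insertNth_inj_base p h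
      exact ⟨hb, Or.inl rfl⟩
  · rintro ⟨hc, rfl | rfl⟩
    · exact Or.inr ⟨c, hc, rfl⟩
    · by_cases hmc : Moves δ o k c
      · obtain rfl := huniq c hc hmc
        exact Or.inl (by rw [colLevel, level_succ_of_mem hm.1 hm.2]; rfl)
      · exact Or.inr ⟨c, hc, by rw [colLevel, colLevel, level_succ_of_not_mem hmc]⟩

theorem new_not_mem_image {n : ℕ} (p : Fin (n + 1)) (δ : ℕ) (o : (Fin n → ℕ) → ℕ) (k : ℕ)
    (τ : Finset (Fin n → ℕ)) (i : Fin n → ℕ) :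
    (p.insertNth (colLevel δ o k i + 1) i : Fin (n + 1) → ℕ) ∉
      τ.image fun c => (p.insertNth (colLevel δ o k c) c : Fin (n + 1) → ℕ) := by
  simp only [Finset.mem_image, not_exists, not_and]
  intro c _ h
  obtain ⟨h, rfl⟩ := insertNth_inj_base p h
  omega

/-- The simplex has a vertical edge of length one over `i`, so the difference of `φ` along it must
be the slope in direction `p`. After subtracting that vertical part, the rest is an integral
extension problem on `τ`. -/
theorem isUnimodular_fibreSimplex {n : ℕ} (p : Fin (n + 1)) (δ : ℕ) (o : (Fin n → ℕ) → ℕ) (k : ℕ)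
    {τ : Finset (Fin n → ℕ)} (hτ : IsUnimodular τ) {i : Fin n → ℕ} (hi : i ∈ τ) :
    IsUnimodular (fibreSimplex p δ o k τ i) := by
  refine ⟨?_, fun φ => ?_⟩
  · rw [fibreSimplex, Finset.card_insert_of_notMem (new_not_mem_image p δ o k τ i),
      Finset.card_image_of_injective _ fun b c h => (insertNth_inj_base p h).2, hτ.1]
  · set f : (Fin n → ℕ) → (Fin (n + 1) → ℕ) := fun c => p.insertNth (colLevel δ o k c) c with hf
    set s : ℤ := φ (p.insertNth (colLevel δ o k i + 1) i) - φ (f i) with hs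
    obtain ⟨w, c, h⟩ := hτ.2 fun b => φ (f b) - s * colLevel δ o k b
    refine ⟨p.insertNth s w, c, fun t ht => ?_⟩
    rcases Finset.mem_insert.1 ht with rfl | ht
    · have := h i hi
      simp only [Fin.sum_univ_succAbove _ p, Fin.insertNth_apply_same,
        Fin.insertNth_apply_succAbove]
      push_cast
      linarith
    · obtain ⟨b, hb, rfl⟩ := Finset.mem_image.1 ht
      have := h b hb
      simp only [Fin.sum_univ_succAbove _ p, Fin.insertNth_apply_same,
        Fin.insertNth_apply_succAbove]
      linarith

/-- A discrete intermediate value theorem for sweeps in which all increments happen at moves. -/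
theorem exists_move_between {f : ℕ → ℝ} {P : ℕ → Prop} (hstay : ∀ k, ¬P k → f (k + 1) = f k)
    {z : ℝ} (h0 : f 0 ≤ z) : ∀ K, z ≤ f K → (∃ k < K, P k) →
      ∃ k, P k ∧ f k ≤ z ∧ z ≤ f (k + 1) := by
  intro K
  induction K with
  | zero => rintro _ ⟨k, hk, _⟩; omega
  | succ K ih =>
    rintro hz ⟨k, hk, hP⟩
    by_cases hK : P K
    · rcases le_or_gt (f K) z with h | h
      · exact ⟨K, hK, h, hz⟩
      · refine ih h.le ?_
        -- With no move before `K`, `f K` would equal `f 0`, which is at most `z`.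
        by_contra! hno
        have : ∀ m ≤ K, f m = f 0 := by
          intro m
          induction m with
          | zero => intro _; rfl
          | succ m ihm =>
            intro hm
            rw [hstay m (hno m (by omega)), ihm (by omega)]
        linarith [this K le_rfl]
    · refine ih (by rwa [hstay K hK] at hz) ⟨k, ?_, hP⟩
      rcases Nat.lt_succ_iff_lt_or_eq.1 hk with h | rfl
      · exact h
      · exact absurd hP hK

/-- Write the projection of `x` in barycentric coordinates of a base simplex `τ`. The height over it
of the graph of column levels rises from 0 to the top of the big simplex, so some move carries it
past `x p`. The simplex swept by that move contains `x`. -/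
theorem IsCornerTriangulation.fibre_cover {n δ : ℕ} {𝒯 : Set (Finset (Fin n → ℕ))}
    (h : IsCornerTriangulation n δ 𝒯) (p : Fin (n + 1)) (o : (Fin n → ℕ) → ℕ)
    (huniq : ∀ τ ∈ 𝒯, ∀ c ∈ τ, ∀ i ∈ τ, ∀ k, Moves δ o k i → Moves δ o k c → c = i)
    (x : Fin (n + 1) → ℝ) (hx : ∀ j, 0 ≤ x j) (hs : ∑ j, x j ≤ δ) :
    ∃ T ∈ fibreSimplices p δ o 𝒯, ∃ l : (Fin (n + 1) → ℕ) → ℝ, (∀ t ∈ T, 0 ≤ l t) ∧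
      ∑ t ∈ T, l t = 1 ∧ ∀ j, ∑ t ∈ T, l t * (t j : ℝ) = x j := by
  rw [Fin.sum_univ_succAbove _ p] at hs
  obtain ⟨τ, hτ, l, hl0, hl1, hlx⟩ := h.cover (p.removeNth x) (fun j => hx _)
    (by have := hx p; simp only [Fin.removeNth]; linarith)
  simp only [Fin.removeNth] at hlx
  set f : ℕ → ℝ := fun k => ∑ c ∈ τ, l c * colLevel δ o k c with hf
  have htop : ∑ c ∈ τ, l c * (colHeight δ c : ℝ) = δ - ∑ j, x (p.succAbove j) := by
    have : ∀ c ∈ τ, l c * (colHeight δ c : ℝ) = l c * δ - ∑ j, l c * (c j : ℝ) := by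
      intro c hc
      have := mem_cornerPoints.1 (h.subset τ hτ hc)
      rw [colHeight, Nat.cast_sub this, mul_sub, Nat.cast_sum, Finset.mul_sum]
    rw [Finset.sum_congr rfl this, Finset.sum_sub_distrib, ← Finset.sum_mul, hl1, one_mul,
      Finset.sum_comm]
    simp only [hlx]
  obtain ⟨k, ⟨i, hi, hmi⟩, hk1, hk2⟩ : ∃ k, (∃ i ∈ τ, Moves δ o k i) ∧ f k ≤ x p ∧
      x p ≤ f (k + 1) := by
    refine exists_move_between (f := f) (fun k hk => ?_) (z := x p) ?_
      (∑ c ∈ τ, (o c + colHeight δ c)) ?_ ?_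
    · refine Finset.sum_congr rfl fun c hc => ?_
      rw [colLevel, colLevel, level_succ_of_not_mem fun hm => hk ⟨c, hc, hm⟩]
    · have : f 0 = 0 := Finset.sum_eq_zero fun c _ => by simp [colLevel, level]
      rw [this]; exact hx p
    · have : f (∑ c ∈ τ, (o c + colHeight δ c)) = ∑ c ∈ τ, l c * (colHeight δ c : ℝ) := by
        refine Finset.sum_congr rfl fun c hc => ?_
        have := Finset.single_le_sum (f := fun c => o c + colHeight δ c)
          (fun j _ => Nat.zero_le _) hc
        have : colLevel δ o (∑ c ∈ τ, (o c + colHeight δ c)) c = colHeight δ c := by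
          simp only [colLevel, level] at *; omega
        rw [this]
      rw [this, htop]; linarith
    -- The height function may be constant, for example when all the weight sits on columns of
    -- height zero. A column of positive height over `τ` still guarantees that there is a move.
    · obtain ⟨c, hc, hlt⟩ := h.exists_lt τ hτ
      have hpos : 0 < colHeight δ c := by unfold colHeight; omega
      refine ⟨o c, ?_, c, hc, le_rfl, by omega⟩
      have := Finset.single_le_sum (f := fun c => o c + colHeight δ c)
          (fun j _ => Nat.zero_le _) hc
      omega
  have hstep : f (k + 1) = f k + l i := by
    rw [hf]
    simp only
    rw [← Finset.add_sum_erase _ _ hi, ← Finset.add_sum_erase _ _ hi]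
    have : ∑ c ∈ τ.erase i, l c * (colLevel δ o (k + 1) c : ℝ)
        = ∑ c ∈ τ.erase i, l c * (colLevel δ o k c : ℝ) := by
      refine Finset.sum_congr rfl fun c hc => ?_
      rw [Finset.mem_erase] at hc
      rw [colLevel, colLevel, level_succ_of_not_mem fun hm =>
        hc.1 (huniq τ hτ c hc.2 i hi k hmi hm)]
    rw [this, colLevel, level_succ_of_mem hmi.1 hmi.2]
    simp only [colLevel]
    push_cast
    ring
  set s : ℝ := x p - f k with hsdef
  set e : (Fin n → ℕ) → (Fin (n + 1) → ℕ) := fun c => p.insertNth (colLevel δ o k c) c with he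
  set q : Fin (n + 1) → ℕ := p.insertNth (colLevel δ o k i + 1) i with hq
  have hinj : Function.Injective e := fun b c h => (insertNth_inj_base p h).2
  have hqe : ∀ c ∈ τ, e c ≠ q := by
    intro c hc heq
    exact new_not_mem_image p δ o k τ i (Finset.mem_image.2 ⟨c, hc, heq⟩)
  -- Starting from the level graph at time `k`, the missing height `s` is gained by shifting weight
  -- `s` from the lower to the upper end of the vertical edge over `i`.
  set L : (Fin (n + 1) → ℕ) → ℝ := fun t =>
    if t = q then s else l (p.removeNth t) - if p.removeNth t = i then s else 0 with hL
  have hLe : ∀ c ∈ τ, L (e c) = l c - if c = i then s else 0 := by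
    intro c hc
    simp only [hL, if_neg (hqe c hc)]
    simp [he]
  have hLq : L q = s := by simp [hL]
  have hsum : ∀ F : (Fin (n + 1) → ℕ) → ℝ, ∑ t ∈ fibreSimplex p δ o k τ i, L t * F t =
      s * F q + (∑ c ∈ τ, l c * F (e c) - s * F (e i)) := by
    intro F
    rw [fibreSimplex, Finset.sum_insert (new_not_mem_image p δ o k τ i),
      Finset.sum_image fun b _ c _ h => hinj h]
    have : ∀ c ∈ τ, L (e c) * F (e c) = l c * F (e c) - if c = i then s * F (e c) else 0 := by
      intro c hc
      rw [hLe c hc]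
      split_ifs <;> ring
    rw [← hq, hLq, Finset.sum_congr rfl this, Finset.sum_sub_distrib, Finset.sum_ite_eq', if_pos hi]
  refine ⟨_, ⟨τ, hτ, i, hi, k, hmi, rfl⟩, L, ?_, ?_, ?_⟩
  · intro t ht
    rcases Finset.mem_insert.1 ht with rfl | ht
    · rw [hLq]; linarith
    · obtain ⟨c, hc, rfl⟩ := Finset.mem_image.1 ht
      change 0 ≤ L (e c)
      rw [hLe c hc]
      split_ifs with hci
      · subst hci; linarith
      · simpa using hl0 c hc
  · have := hsum fun _ => 1
    simp only [mul_one] at this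
    rw [this, hl1]; ring
  · intro j
    rw [hsum fun t => (t j : ℝ)]
    refine p.succAboveCases ?_ (fun j => ?_) j
    · simp only [hq, he, Fin.insertNth_apply_same]
      push_cast
      simp only [hf] at hsdef
      linarith
    · simp only [hq, he, Fin.insertNth_apply_succAbove, hlx]
      ring

theorem toReal_dot_insertNth {n : ℕ} (p : Fin (n + 1)) (s : ℝ) (u : Fin n → ℝ) (z : ℕ)
    (b : Fin n → ℕ) : (p.insertNth s u : Fin (n + 1) → ℝ) ⬝ᵥ toReal (p.insertNth z b) =
      s * z + u ⬝ᵥ toReal b := by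
  simp [dotProduct, toReal, Fin.sum_univ_succAbove _ p]

theorem eventually_add_mul_pos {a b : ℝ} (ha : 0 < a) : ∀ᶠ ε in 𝓝[>] (0 : ℝ), 0 < a + ε * b := by
  have : Tendsto (fun ε : ℝ => a + ε * b) (𝓝[>] 0) (𝓝 (a + 0 * b)) :=
    (Continuous.tendsto (by fun_prop) 0).mono_left nhdsWithin_le_nhds
  exact this.eventually (lt_mem_nhds (by simpa))

/-- The step from z to z + 1 over `b` costs 2ε(o b + z), that is, 2ε times the moment at which it is
made. A functional with vertical slope 2εk therefore sees each column peak exactly at its levels at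
times `k` and `k + 1`. Base points outside `τ` have a strict gap in the base lift, which survives
for small ε. -/
theorem IsCornerTriangulation.fibre_supports {n δ : ℕ} {𝒯 : Set (Finset (Fin n → ℕ))}
    (h : IsCornerTriangulation n δ 𝒯) (p : Fin (n + 1)) (o : (Fin n → ℕ) → ℕ)
    {g : (Fin n → ℕ) → ℝ} {τ : Finset (Fin n → ℕ)} (hτ : τ ∈ 𝒯)
    (hg : Supports (cornerPoints n δ) g τ) {i : Fin n → ℕ} (hi : i ∈ τ) {k : ℕ}
    (hm : Moves δ o k i) (huniq : ∀ c ∈ τ, Moves δ o k c → c = i) :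
    ∀ᶠ ε in 𝓝[>] (0 : ℝ), Supports (cornerPoints (n + 1) δ)
      (fun a => g (p.removeNth a) - ε * (a p * (2 * o (p.removeNth a) + a p - 1)))
      (fibreSimplex p δ o k τ i) := by
  obtain ⟨u, c, hu⟩ := hg
  -- This affine function interpolates the column maxima at the vertices of `τ`. Subtracting ε times
  -- it brings the peaks of all columns over `τ` to one common value.
  obtain ⟨w, d, hw⟩ := (h.unimodular τ hτ).exists_affine fun b =>
    colLevel δ o k b * (2 * (k - o b) + 1 - colLevel δ o k b)
  have hfin : ∀ᶠ ε in 𝓝[>] (0 : ℝ), ∀ a ∈ cornerPoints (n + 1) δ, p.removeNth a ∉ τ →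
      0 < (c - (u ⬝ᵥ toReal (p.removeNth a) + g (p.removeNth a))) +
        ε * (w ⬝ᵥ toReal (p.removeNth a) + d - a p * (2 * (k - o (p.removeNth a)) + 1 - a p)) := by
    rw [Filter.eventually_all_finset]
    intro a ha
    by_cases haτ : p.removeNth a ∈ τ
    · simp [haτ]
    · simp only [haτ, not_false_eq_true, forall_const]
      have hsum := mem_cornerPoints.1 ha
      rw [Fin.sum_univ_succAbove _ p] at hsum
      have hb := hu (p.removeNth a) (mem_cornerPoints.2 (by simp only [Fin.removeNth]; omega))
      exact eventually_add_mul_pos (sub_pos.2 (lt_of_le_of_ne hb.1 fun he => haτ (hb.2.1 he)))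
  filter_upwards [hfin, self_mem_nhdsWithin] with ε hε hε0
  rw [Set.mem_Ioi] at hε0
  refine ⟨p.insertNth (ε * (2 * k)) (u - ε • w), c + ε * d, fun a ha => ?_⟩
  have hsum := mem_cornerPoints.1 ha
  have hεa := hε a ha
  obtain ⟨z, b, rfl⟩ : ∃ (z : ℕ) (b : Fin n → ℕ), a = p.insertNth z b :=
    ⟨a p, p.removeNth a, (Fin.insertNth_self_removeNth p a).symm⟩
  rw [mem_fibreSimplex hi hm huniq, toReal_dot_insertNth]
  simp only [Fin.removeNth_insertNth, Fin.insertNth_apply_same] at hεa ⊢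
  simp only [Fin.sum_univ_succAbove _ p, Fin.insertNth_apply_same,
    Fin.insertNth_apply_succAbove] at hsum
  have hb := hu b (mem_cornerPoints.2 (by omega))
  have hz : z ≤ colHeight δ b := by unfold colHeight; omega
  have hcol := column_max (o b) (colHeight δ b) k z hz
  rw [sub_dotProduct, smul_dotProduct, smul_eq_mul]
  by_cases hbτ : b ∈ τ
  · have hwb := hw b hbτ
    have hub := hb.2.2 hbτ
    simp only [colLevel] at hwb
    simp only [hbτ, true_and, colLevel]
    rw [← hcol.2, ← hwb]
    rw [← hwb] at hcol
    have key : ε * (2 * k) * z + (u ⬝ᵥ toReal b - ε * w ⬝ᵥ toReal b) +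
        (g b - ε * (z * (2 * o b + z - 1))) = c + ε * d -
        ε * (w ⬝ᵥ toReal b + d - z * (2 * (k - o b) + 1 - z)) := by
      rw [← hub]; ring
    rw [key]
    refine ⟨?_, fun he => ?_, fun he => ?_⟩
    · have := mul_nonneg hε0.le (sub_nonneg.2 hcol.1)
      linarith
    · have : ε * (w ⬝ᵥ toReal b + d - z * (2 * (k - o b) + 1 - z)) = 0 := by linarith
      rcases mul_eq_zero.1 this with h | h
      · exact absurd h hε0.ne'
      · linarith
    · rw [he]; ring
  · have := hεa hbτ
    simp only [hbτ, false_and, iff_false]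
    constructor
    · linarith
    · intro he
      linarith

theorem IsCornerTriangulation.fibre {n δ : ℕ} {𝒯 : Set (Finset (Fin n → ℕ))}
    (h : IsCornerTriangulation n δ 𝒯) (p : Fin (n + 1)) (o : (Fin n → ℕ) → ℕ)
    (ho : ∀ b ∈ cornerPoints n δ, ∀ c ∈ cornerPoints n δ, b ≠ c →
      o b + δ ≤ o c ∨ o c + δ ≤ o b) :
    IsCornerTriangulation (n + 1) δ (fibreSimplices p δ o 𝒯) := by
  -- Columns have height at most δ, so starting times at least δ apart give disjoint growth
  -- intervals.
  have huniq : ∀ τ ∈ 𝒯, ∀ c ∈ τ, ∀ i ∈ τ, ∀ k, Moves δ o k i → Moves δ o k c → c = i := by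
    intro τ hτ c hc i hi k hmi hmc
    by_contra hne
    have := ho c (h.subset τ hτ hc) i (h.subset τ hτ hi) hne
    simp only [Moves, colHeight] at hmi hmc
    omega
  have hsub : ∀ T ∈ fibreSimplices p δ o 𝒯, T ⊆ cornerPoints (n + 1) δ := by
    rintro _ ⟨τ, hτ, i, hi, k, hm, rfl⟩ t ht
    rw [mem_cornerPoints]
    rcases Finset.mem_insert.1 ht with rfl | ht
    · have := mem_cornerPoints.1 (h.subset τ hτ hi)
      have h2 := level_eq_of_mem hm.1 hm.2
      simp only [Fin.sum_univ_succAbove _ p, Fin.insertNth_apply_same,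
        Fin.insertNth_apply_succAbove]
      simp only [Moves, colHeight, colLevel] at *
      omega
    · obtain ⟨b, hb, rfl⟩ := Finset.mem_image.1 ht
      have := mem_cornerPoints.1 (h.subset τ hτ hb)
      have h2 := level_le (o b) (colHeight δ b) k
      simp only [Fin.sum_univ_succAbove _ p, Fin.insertNth_apply_same,
        Fin.insertNth_apply_succAbove]
      simp only [colHeight, colLevel] at *
      omega
  refine ⟨hsub, ?_, ?_, h.fibre_cover p o huniq, ?_⟩
  · rintro _ ⟨τ, hτ, i, hi, k, hm, rfl⟩
    exact isUnimodular_fibreSimplex p δ o k (h.unimodular τ hτ) hi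
  · rintro _ ⟨τ, hτ, i, hi, k, hm, rfl⟩
    refine ⟨p.insertNth (colLevel δ o k i) i,
      Finset.mem_insert_of_mem (Finset.mem_image.2 ⟨i, hi, rfl⟩), ?_⟩
    have := mem_cornerPoints.1 (h.subset τ hτ hi)
    have h2 := level_eq_of_mem hm.1 hm.2
    simp only [Fin.sum_univ_succAbove _ p, Fin.insertNth_apply_same,
      Fin.insertNth_apply_succAbove]
    simp only [Moves, colHeight, colLevel] at *
    omega
  · obtain ⟨g, hg⟩ := h.regular
    -- Finiteness allows a single ε to serve all simplices.
    have hfin : (fibreSimplices p δ o 𝒯).Finite :=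
      (Finset.finite_toSet (cornerPoints (n + 1) δ).powerset).subset fun T hT => by
        simpa using hsub T hT
    have : ∀ᶠ ε in 𝓝[>] (0 : ℝ), ∀ T ∈ fibreSimplices p δ o 𝒯,
        Supports (cornerPoints (n + 1) δ)
          (fun a => g (p.removeNth a) - ε * (a p * (2 * o (p.removeNth a) + a p - 1))) T := by
      rw [Filter.eventually_all_finite hfin]
      rintro _ ⟨τ, hτ, i, hi, k, hm, rfl⟩
      exact h.fibre_supports p o hτ (hg τ hτ) hi hm fun c hc hmc => huniq τ hτ c hc i hi k hm hmc
    obtain ⟨ε, hε⟩ := this.exists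
    exact ⟨_, hε⟩

/-! ### A triangulation with a prescribed tetrahedron -/

theorem exists_cornerTriangulation {δ : ℕ} (hδ : 0 < δ) :
    ∃ 𝒯, IsCornerTriangulation 3 δ 𝒯 ∧
      ({![0, 0, 0], ![0, 0, 1], ![δ - 1, 1, 0], ![1, 0, δ - 1]} : Finset (Fin 3 → ℕ)) ∈ 𝒯 := by
  -- The factor δ + 1 spaces the starting times. In `o₁` and `o₂` the column over a larger first
  -- coordinate fills earlier. In `o₂` the term `(δ + 1) * b 1` makes the second coordinate the
  -- leading digit in base δ + 1, so distinct columns start at distinct times.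
  set o₁ : (Fin 1 → ℕ) → ℕ := fun b => (δ - b 0) * (δ + 1) with ho₁
  set o₂ : (Fin 2 → ℕ) → ℕ := fun b => (δ - b 0 + (δ + 1) * b 1) * (δ + 1) with ho₂
  have sep : ∀ {x y : ℕ}, x ≠ y →
      x * (δ + 1) + δ ≤ y * (δ + 1) ∨ y * (δ + 1) + δ ≤ x * (δ + 1) := by
    intro x y hxy
    rcases Nat.lt_or_gt_of_ne hxy with h | h
    · left; nlinarith
    · right; nlinarith
  have h₁ : IsCornerTriangulation 1 δ _ := (isCornerTriangulation_zero hδ).fibre 0 (fun _ => 0)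
    fun b _ c _ hbc => absurd (Subsingleton.elim b c) hbc
  have h₂ : IsCornerTriangulation 2 δ _ := h₁.fibre 0 o₁ (by
    intro b hb c hc hbc
    refine sep fun he => hbc ?_
    rw [mem_cornerPoints] at hb hc
    simp only [Finset.univ_unique, Finset.sum_singleton, Fin.default_eq_zero] at hb hc
    ext j
    rw [Subsingleton.elim j 0]
    omega)
  have h₃ : IsCornerTriangulation 3 δ _ := h₂.fibre 2 o₂ (by
    intro b hb c hc hbc
    refine sep fun he => hbc ?_
    rw [mem_cornerPoints] at hb hc
    simp only [Fin.sum_univ_two] at hb hc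
    have h1 : b 1 = c 1 := by
      rcases Nat.lt_trichotomy (b 1) (c 1) with h | h | h
      · have := Nat.mul_le_mul_left (δ + 1) h
        simp only [Nat.succ_eq_add_one, mul_add] at this
        omega
      · exact h
      · have := Nat.mul_le_mul_left (δ + 1) h
        simp only [Nat.succ_eq_add_one, mul_add] at this
        omega
    rw [h1] at he
    ext j
    fin_cases j
    · show b 0 = c 0
      omega
    · exact h1)
  have hsq : δ * (δ + 1) - (δ - 1) * (δ + 1) = δ + 1 := by
    rw [← Nat.sub_mul]; simp [Nat.sub_sub_self hδ]
  -- At time δ(δ+1) in the plane, the column over 1 is full at level δ - 1 and the column over 0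
  -- makes its first step, which gives this triangle. At time δ(δ+1) in space, the column over (1,0)
  -- is full at level δ - 1 and the one over (0,0) makes its first step, which gives Ω_δ.
  refine ⟨_, h₃, {![0, 0], ![1, 0], ![δ - 1, 1]}, ⟨{![0], ![1]}, ⟨{![]}, rfl, ![], by simp, 0,
    ⟨by simp, by simpa [colHeight]⟩, ?_⟩, ![0], by simp, δ * (δ + 1), ⟨by simp [ho₁], ?_⟩, ?_⟩,
    ![0, 0], by simp, δ * (δ + 1), ⟨by simp [ho₂], ?_⟩, ?_⟩
  · have h0 : colLevel δ (fun _ : Fin 0 → ℕ => 0) 0 ![] = 0 := by simp [colLevel, level]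
    rw [fibreSimplex, Finset.image_singleton, h0]
    simp only [Fin.insertNth_zero', zero_add]
    rw [Finset.pair_comm]
    rfl
  · simp only [ho₁, colHeight]
    simp [hδ]
  · have h0 : colLevel δ o₁ (δ * (δ + 1)) ![0] = 0 := by simp [colLevel, level, ho₁]
    have h1 : colLevel δ o₁ (δ * (δ + 1)) ![1] = δ - 1 := by
      simp [colLevel, level, ho₁, colHeight, hsq]
      omega
    rw [fibreSimplex, Finset.image_insert, Finset.image_singleton, h0, h1]
    simp only [Fin.insertNth_zero', zero_add]
    rw [Finset.insert_comm]
    rfl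
  · simp only [ho₂, colHeight]
    simp [hδ]
  · have h0 : colLevel δ o₂ (δ * (δ + 1)) ![0, 0] = 0 := by simp [colLevel, level, ho₂]
    have h1 : colLevel δ o₂ (δ * (δ + 1)) ![1, 0] = δ - 1 := by
      simp [colLevel, level, ho₂, colHeight, hsq]
      omega
    -- This column has height zero, because its foot has coordinate sum δ.
    have h2 : colLevel δ o₂ (δ * (δ + 1)) ![δ - 1, 1] = 0 := by
      simp [colLevel, level, colHeight, Nat.sub_add_cancel hδ]
    have hins : ∀ x y z : ℕ, ((2 : Fin 3).insertNth z ![x, y] : Fin 3 → ℕ) = ![x, y, z] := by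
      intro x y z
      ext j
      fin_cases j <;> rfl
    rw [fibreSimplex, Finset.image_insert, Finset.image_insert, Finset.image_singleton, h0, h1, h2]
    simp only [hins, zero_add]
    rw [Finset.insert_comm, Finset.pair_comm ![δ - 1, 1, 0]]

/-! ### Faces of convex hulls of finite sets -/

theorem toReal_injective {n : ℕ} : Function.Injective (toReal (n := n)) := by
  intro a b h
  ext i
  have := congrFun h i
  simp only [toReal] at this
  exact_mod_cast this

theorem mem_convexHull_toReal {n : ℕ} {T : Finset (Fin n → ℕ)} {x : Fin n → ℝ} :
    x ∈ convexHull ℝ (toReal '' (T : Set (Fin n → ℕ))) ↔ ∃ l : (Fin n → ℕ) → ℝ,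
      (∀ t ∈ T, 0 ≤ l t) ∧ ∑ t ∈ T, l t = 1 ∧ ∑ t ∈ T, l t • toReal t = x := by
  classical
  rw [← Finset.coe_image, Finset.mem_convexHull']
  constructor
  · rintro ⟨w, h0, h1, h2⟩
    rw [Finset.sum_image fun a _ b _ h => toReal_injective h] at h1 h2
    exact ⟨fun t => w (toReal t), fun t ht => h0 _ (Finset.mem_image_of_mem _ ht), h1, h2⟩
  · rintro ⟨l, h0, h1, h2⟩
    have key : ∀ t, l (Function.invFun toReal (toReal t)) = l t := fun t => by
      rw [Function.leftInverse_invFun toReal_injective t]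
    refine ⟨fun y => l (Function.invFun toReal y), ?_, ?_, ?_⟩
    · intro y hy
      obtain ⟨t, ht, rfl⟩ := Finset.mem_image.1 hy
      simp only [key]
      exact h0 t ht
    · rw [Finset.sum_image fun a _ b _ h => toReal_injective h]
      simpa only [key] using h1
    · rw [Finset.sum_image fun a _ b _ h => toReal_injective h]
      simpa only [key] using h2

theorem linear_le_on_convexHull {E : Type*} [AddCommGroup E] [Module ℝ E] {V : Set E}
    {l : E →ₗ[ℝ] ℝ} {c : ℝ} (h : ∀ v ∈ V, l v ≤ c) {x : E} (hx : x ∈ convexHull ℝ V) : l x ≤ c :=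
  convexHull_min h (convex_halfSpace_le l.isLinear c) hx

/-- The weighted slacks `w v * (c - l v)` are nonnegative with sum zero, so every generator off the
hyperplane has weight zero. -/
theorem mem_convexHull_of_linear_eq {E : Type*} [AddCommGroup E] [Module ℝ E] {V : Set E}
    (hV : V.Finite) {l : E →ₗ[ℝ] ℝ} {c : ℝ} (h : ∀ v ∈ V, l v ≤ c) {x : E}
    (hx : x ∈ convexHull ℝ V) (hxc : l x = c) : x ∈ convexHull ℝ {v ∈ V | l v = c} := by
  classical
  lift V to Finset E using hV
  obtain ⟨w, h0, h1, rfl⟩ := Finset.mem_convexHull'.1 hx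
  simp only [Finset.mem_coe] at h
  have hz : ∀ v ∈ V, w v * (c - l v) = 0 := by
    rw [← Finset.sum_eq_zero_iff_of_nonneg fun v hv => mul_nonneg (h0 v hv) (sub_nonneg.2 (h v hv))]
    simp only [map_sum, map_smul, smul_eq_mul] at hxc
    simp only [mul_sub, Finset.sum_sub_distrib, ← Finset.sum_mul, h1, hxc]
    ring
  have hsub : V.filter (fun v => l v = c) ⊆ V := Finset.filter_subset _ _
  have hw : ∀ v ∈ V, v ∉ V.filter (fun v => l v = c) → w v = 0 := by
    intro v hv hv'
    simp only [Finset.mem_filter, hv, true_and] at hv'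
    rcases mul_eq_zero.1 (hz v hv) with h | h
    · exact h
    · exact absurd (by linarith) hv'
  have : {v ∈ (V : Set E) | l v = c} = ((V.filter fun v => l v = c : Finset E) : Set E) := by
    ext; simp
  rw [this, Finset.mem_convexHull']
  refine ⟨w, fun v hv => h0 v (hsub hv), ?_, ?_⟩
  · rw [Finset.sum_subset hsub hw, h1]
  · rw [Finset.sum_subset hsub fun v hv hv' => by rw [hw v hv hv', zero_smul]]

theorem maximisers_convexHull {E : Type*} [AddCommGroup E] [Module ℝ E] {V : Set E}
    (hV : V.Finite) (l : E →ₗ[ℝ] ℝ) :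
    {x ∈ convexHull ℝ V | ∀ y ∈ convexHull ℝ V, l y ≤ l x} =
      convexHull ℝ {v ∈ V | ∀ w ∈ V, l w ≤ l v} := by
  rcases V.eq_empty_or_nonempty with rfl | hne
  · simp
  obtain ⟨m, hm, hmax⟩ := hV.exists_maximalFor l V hne
  have hle : ∀ w ∈ V, l w ≤ l m := fun w hw => (le_total (l w) (l m)).elim id fun h => hmax hw h
  have hset : {v ∈ V | ∀ w ∈ V, l w ≤ l v} = {v ∈ V | l v = l m} := by
    ext v
    exact and_congr_right fun hv => ⟨fun h => le_antisymm (hle v hv) (h m hm),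
      fun h w hw => h ▸ hle w hw⟩
  rw [hset]
  apply Set.Subset.antisymm
  · rintro x ⟨hx, hxm⟩
    exact mem_convexHull_of_linear_eq hV hle hx
      (le_antisymm (linear_le_on_convexHull hle hx) (hxm m (subset_convexHull ℝ V hm)))
  · intro x hx
    have h1 : l x = l m := by
      have := convexHull_min (fun v (hv : v ∈ {v ∈ V | l v = l m}) => hv.2)
        (convex_hyperplane l.isLinear (l m)) hx
      exact this
    exact ⟨convexHull_mono (fun v hv => hv.1) hx, fun y hy => h1 ▸ linear_le_on_convexHull hle hy⟩

/-! ### Unimodular simplices -/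

/-- Applying the affine function that is 1 at one vertex and 0 at the others to a dependence
relation isolates that vertex's coefficient. -/
theorem IsUnimodular.affineIndependent {n : ℕ} {T : Finset (Fin n → ℕ)} (hT : IsUnimodular T) :
    AffineIndependent ℝ fun t : T => toReal t.1 := by
  rw [affineIndependent_iff]
  intro s w hw0 hw1 t ht
  obtain ⟨v, c, h⟩ := hT.exists_affine fun a => if a = t.1 then 1 else 0
  have h1 := congrArg (fun y => v ⬝ᵥ y) hw1
  simp only [dotProduct_sum, dotProduct_smul, smul_eq_mul, dotProduct_zero] at h1
  have h2 : ∀ r ∈ s, w r * (v ⬝ᵥ toReal r.1) = (if r = t then w r else 0) - w r * c := by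
    intro r _
    have := h r.1 r.2
    simp only [Subtype.coe_inj] at this
    split_ifs at this ⊢ <;> linear_combination w r * this
  rw [Finset.sum_congr rfl h2, Finset.sum_sub_distrib, ← Finset.sum_mul, hw0] at h1
  simpa [ht] using h1

theorem IsUnimodular.affineSpan_eq_top {n : ℕ} {T : Finset (Fin n → ℕ)} (hT : IsUnimodular T) :
    affineSpan ℝ (toReal '' (T : Set (Fin n → ℕ))) = ⊤ := by
  have h := hT.affineIndependent.affineSpan_eq_top_iff_card_eq_finrank_add_one.2
    (by simp [hT.1])
  rw [← h]
  congr 1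
  ext; simp

theorem IsUnimodular.affine_eq_zero {n : ℕ} {T : Finset (Fin n → ℕ)} (hT : IsUnimodular T)
    {v : Fin n → ℝ} {d : ℝ} (h : ∀ t ∈ T, v ⬝ᵥ toReal t + d = 0) (x : Fin n → ℝ) :
    v ⬝ᵥ x + d = 0 := by
  let f : (Fin n → ℝ) →ᵃ[ℝ] ℝ :=
    (dotProductBilin ℝ ℝ v).toAffineMap + AffineMap.const ℝ (Fin n → ℝ) d
  have hx : x ∈ affineSpan ℝ (toReal '' (T : Set (Fin n → ℕ))) := by
    rw [hT.affineSpan_eq_top]; trivial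
  have hmem : f x ∈ affineSpan ℝ (f '' (toReal '' (T : Set (Fin n → ℕ)))) := by
    rw [← AffineSubspace.map_span]
    exact ⟨x, hx, rfl⟩
  have hsub : f '' (toReal '' (T : Set (Fin n → ℕ))) ⊆ {0} := by
    rintro _ ⟨_, ⟨t, ht, rfl⟩, rfl⟩
    exact h t ht
  have := affineSpan_mono ℝ hsub hmem
  rw [AffineSubspace.mem_affineSpan_singleton] at this
  exact this

/-- The only lattice points of a unimodular simplex are its vertices. -/
theorem IsUnimodular.mem_of_mem_convexHull {n : ℕ} {T : Finset (Fin n → ℕ)} (hT : IsUnimodular T)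
    {a : Fin n → ℕ} (ha : toReal a ∈ convexHull ℝ (toReal '' (T : Set (Fin n → ℕ)))) : a ∈ T := by
  obtain ⟨l, h0, h1, h2⟩ := mem_convexHull_toReal.1 ha
  obtain ⟨t, ht, hlt⟩ : ∃ t ∈ T, l t ≠ 0 := by
    by_contra! h
    rw [Finset.sum_eq_zero h] at h1
    exact zero_ne_one h1
  -- Barycentric coordinates are values of integral affine functions, hence integers at a lattice
  -- point. Nonnegative integers with sum 1 are all 0 except for a single 1.
  have hint : ∀ s ∈ T, ∃ z : ℤ, l s = z := by
    intro s hs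
    obtain ⟨w, c, h⟩ := hT.exists_indicator s
    refine ⟨∑ j, w j * (a j : ℤ) + c, ?_⟩
    have h3 : ∀ t ∈ T, (fun j => (w j : ℝ)) ⬝ᵥ toReal t + c = if t = s then 1 else 0 := by
      intro t ht
      have := congrArg (Int.cast : ℤ → ℝ) (h t ht)
      push_cast at this
      exact this
    have h4 : (fun j => (w j : ℝ)) ⬝ᵥ toReal a + c = l s := by
      rw [← h2, dotProduct_sum]
      simp only [dotProduct_smul, smul_eq_mul]
      have : ∀ t ∈ T, l t * ((fun j => (w j : ℝ)) ⬝ᵥ toReal t)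
          = (if t = s then l t else 0) - l t * c := by
        intro t ht
        rw [eq_sub_of_add_eq (h3 t ht)]
        split_ifs <;> ring
      rw [Finset.sum_congr rfl this, Finset.sum_sub_distrib, ← Finset.sum_mul, h1]
      simp [hs]
    rw [← h4]
    push_cast
    rfl
  have hle : ∀ s ∈ T, l s ≤ 1 := fun s hs => h1 ▸ Finset.single_le_sum h0 hs
  have hlt1 : l t = 1 := by
    obtain ⟨z, hz⟩ := hint t ht
    have h5 := h0 t ht
    have h6 := hle t ht
    rw [hz] at h5 h6 hlt ⊢
    have h5' : 0 ≤ z := by exact_mod_cast h5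
    have h6' : z ≤ 1 := by exact_mod_cast h6
    have h7 : z ≠ 0 := by exact_mod_cast hlt
    have : z = 1 := by omega
    simp [this]
  have hrest : ∀ s ∈ T, s ≠ t → l s = 0 := by
    have h8 := Finset.add_sum_erase T l ht
    rw [h1, hlt1] at h8
    have h9 : ∑ s ∈ T.erase t, l s = 0 := by linarith
    rw [Finset.sum_eq_zero_iff_of_nonneg fun s hs => h0 s (Finset.mem_of_mem_erase hs)] at h9
    exact fun s hs hst => h9 s (Finset.mem_erase.2 ⟨hst, hs⟩)
  rw [Finset.sum_eq_single_of_mem t ht fun s hs hst => by rw [hrest s hs hst, zero_smul], hlt1,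
    one_smul] at h2
  rwa [← toReal_injective h2]

/-- A set of lattice points whose convex hull is a unimodular simplex is its set of vertices. -/
theorem IsUnimodular.eq_of_convexHull_eq {n : ℕ} {T : Finset (Fin n → ℕ)} (hT : IsUnimodular T)
    {M : Set (Fin n → ℕ)}
    (h : convexHull ℝ (toReal '' M) = convexHull ℝ (toReal '' (T : Set (Fin n → ℕ)))) :
    M = T := by
  have hsub : M ⊆ T := fun m hm => hT.mem_of_mem_convexHull
    (h ▸ subset_convexHull ℝ _ (Set.mem_image_of_mem _ hm))
  refine Set.Subset.antisymm hsub fun t ht => ?_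
  by_contra htM
  -- If `M` misses `t`, this function vanishes on the hull of `M` but is 1 at `t`.
  obtain ⟨w, c, hw⟩ := hT.exists_affine fun a => if a = t then 1 else 0
  have h1 : toReal t ∈ convexHull ℝ (toReal '' M) :=
    h ▸ subset_convexHull ℝ _ (Set.mem_image_of_mem _ ht)
  have h2 : w ⬝ᵥ toReal t ≤ -c := by
    refine linear_le_on_convexHull (l := dotProductBilin ℝ ℝ w) ?_ h1
    rintro _ ⟨m, hm, rfl⟩
    have := hw m (hsub hm)
    have hmt : m ≠ t := by
      rintro rfl
      exact htM hm
    rw [if_neg hmt] at this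
    change w ⬝ᵥ toReal m ≤ -c
    linarith
  have := hw t ht
  simp only [if_true] at this
  linarith

/-! ### Marked cells -/

/-- The marked points of the top face of the lift `β` in direction `u`. -/
def markAt {n : ℕ} (A : Finset (Fin n → ℕ)) (β : A → ℝ) (u : Fin n → ℝ) : Set A :=
  {a : A | ∀ b : A, u ⬝ᵥ toReal b.1 + β b ≤ u ⬝ᵥ toReal a.1 + β a}

/-- The convex hull of a set of points of `A`. -/
def cellOf {n : ℕ} {A : Finset (Fin n → ℕ)} (M : Set A) : Set (Fin n → ℝ) :=
  convexHull ℝ (toReal '' (Subtype.val '' M))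

/-- A maximising face of a hull is the hull of the maximising generators, and projection commutes
with taking hulls. -/
theorem topFace_image {n : ℕ} (A : Finset (Fin n → ℕ)) (β : A → ℝ) (u : Fin n → ℝ) :
    Prod.fst '' {p ∈ liftedPolytope A β | ∀ q ∈ liftedPolytope A β,
      u ⬝ᵥ q.1 + q.2 ≤ u ⬝ᵥ p.1 + p.2} = cellOf (markAt A β u) := by
  have h := maximisers_convexHull (Set.finite_range fun a : A => (toReal a.1, β a))
    ((dotProductBilin ℝ ℝ u).comp (LinearMap.fst ℝ (Fin n → ℝ) ℝ) + LinearMap.snd ℝ (Fin n → ℝ) ℝ)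
  have h' : {p ∈ liftedPolytope A β | ∀ q ∈ liftedPolytope A β,
      u ⬝ᵥ q.1 + q.2 ≤ u ⬝ᵥ p.1 + p.2} = _ := h
  rw [h']
  have h2 := (LinearMap.fst ℝ (Fin n → ℝ) ℝ).image_convexHull
  rw [show (Prod.fst : (Fin n → ℝ) × ℝ → _) = LinearMap.fst ℝ (Fin n → ℝ) ℝ from rfl, h2, cellOf]
  congr 1
  ext x
  simp only [Set.mem_image, Set.mem_ofPred_eq, Set.mem_range]
  constructor
  · rintro ⟨_, ⟨⟨a, rfl⟩, ha⟩, rfl⟩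
    exact ⟨a.1, ⟨a, fun b => ha _ ⟨b, rfl⟩, rfl⟩, rfl⟩
  · rintro ⟨_, ⟨a, ha, rfl⟩, rfl⟩
    refine ⟨(toReal a.1, β a), ⟨⟨a, rfl⟩, ?_⟩, rfl⟩
    rintro _ ⟨b, rfl⟩
    exact ha b

theorem inducedSubdivision_eq {n : ℕ} (A : Finset (Fin n → ℕ)) (β : A → ℝ) :
    inducedSubdivision A β = insert ∅ (cellOf '' markedSubdivision A β) := by
  unfold inducedSubdivision
  congr 1
  ext C
  constructor
  · rintro ⟨_, ⟨u, rfl⟩, rfl⟩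
    exact ⟨_, ⟨u, rfl⟩, (topFace_image A β u).symm⟩
  · rintro ⟨_, ⟨u, rfl⟩, rfl⟩
    exact ⟨_, ⟨u, rfl⟩, (topFace_image A β u).symm⟩

theorem markAt_nonempty {n : ℕ} {A : Finset (Fin n → ℕ)} (hA : A.Nonempty) (β : A → ℝ)
    (u : Fin n → ℝ) : (markAt A β u).Nonempty := by
  have : Nonempty A := hA.to_subtype
  obtain ⟨a, ha⟩ := Finite.exists_max fun a : A => u ⬝ᵥ toReal a.1 + β a
  exact ⟨a, ha⟩

/-- Let `K` be the difference of the two maximal values. The functional `v - u` is at most `K` on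
the first cell and at least `K` on the second, so the two meet precisely where it equals `K` on the
first cell. -/
theorem isExposed_inter {n : ℕ} {A : Finset (Fin n → ℕ)} (β : A → ℝ) (u v : Fin n → ℝ) :
    IsExposed ℝ (cellOf (markAt A β u)) (cellOf (markAt A β u) ∩ cellOf (markAt A β v)) := by
  rintro ⟨x₀, hx₀, hx₀'⟩
  rcases A.eq_empty_or_nonempty with rfl | hA
  · have : ∀ M : Set (∅ : Finset (Fin n → ℕ)), cellOf M = ∅ := fun M => by
      rw [Set.eq_empty_of_isEmpty M]; simp [cellOf]
    rw [this] at hx₀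
    exact hx₀.elim
  obtain ⟨a₀, ha₀⟩ := markAt_nonempty hA β u
  obtain ⟨b₀, hb₀⟩ := markAt_nonempty hA β v
  set K : ℝ := (v ⬝ᵥ toReal b₀.1 + β b₀) - (u ⬝ᵥ toReal a₀.1 + β a₀) with hK
  set l : (Fin n → ℝ) →ₗ[ℝ] ℝ := dotProductBilin ℝ ℝ (v - u) with hl
  have hlv : ∀ y, l y = v ⬝ᵥ y - u ⬝ᵥ y := fun y => sub_dotProduct v u y
  have h1 : ∀ y ∈ toReal '' (Subtype.val '' markAt A β u), l y ≤ K := by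
    rintro _ ⟨_, ⟨a, ha, rfl⟩, rfl⟩
    have e1 := ha a₀
    have e2 := hb₀ a
    rw [hlv]; linarith
  have h2 : ∀ y ∈ toReal '' (Subtype.val '' markAt A β v), (-l) y ≤ -K := by
    rintro _ ⟨_, ⟨b, hb, rfl⟩, rfl⟩
    have e1 := hb b₀
    have e2 := ha₀ b
    rw [LinearMap.neg_apply, hlv]; linarith
  have hC : ∀ y ∈ cellOf (markAt A β u), l y ≤ K := fun y hy => linear_le_on_convexHull h1 hy
  have hC' : ∀ y ∈ cellOf (markAt A β v), K ≤ l y := fun y hy => by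
    have := linear_le_on_convexHull h2 hy
    rw [LinearMap.neg_apply] at this
    linarith
  refine ⟨LinearMap.toContinuousLinearMap l, ?_⟩
  simp only [LinearMap.coe_toContinuousLinearMap']
  ext x
  constructor
  · rintro ⟨hx, hx'⟩
    exact ⟨hx, fun y hy => (hC y hy).trans (hC' x hx')⟩
  · rintro ⟨hx, hmax⟩
    refine ⟨hx, ?_⟩
    have hxK : l x = K := le_antisymm (hC x hx) ((hC' x₀ hx₀').trans (hmax x₀ hx₀))
    have := mem_convexHull_of_linear_eq (Set.toFinite _) h1 hx hxK
    refine convexHull_mono ?_ this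
    rintro _ ⟨⟨_, ⟨a, ha, rfl⟩, rfl⟩, hay⟩
    refine ⟨_, ⟨a, fun b => ?_, rfl⟩, rfl⟩
    have e1 := ha a₀
    have e2 := hb₀ b
    have e3 := ha₀ a
    rw [hlv] at hay
    linarith

/-! ### Lifts inducing a given unimodular triangulation -/

/-- `𝒯` is a set of vertex sets of unimodular simplices that cover the convex hull of `A`. -/
structure IsUnimodularCover {n : ℕ} (A : Finset (Fin n → ℕ)) (𝒯 : Set (Finset (Fin n → ℕ))) :
    Prop where
  subset : ∀ T ∈ 𝒯, T ⊆ A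
  unimodular : ∀ T ∈ 𝒯, IsUnimodular T
  nonempty : 𝒯.Nonempty
  cover : ∀ x ∈ convexHull ℝ (toReal '' (A : Set (Fin n → ℕ))),
    ∃ T ∈ 𝒯, x ∈ convexHull ℝ (toReal '' (T : Set (Fin n → ℕ)))

/-- All members of `𝒯` are marked cells of the lift `β`. -/
def IsLiftOf {n : ℕ} {A : Finset (Fin n → ℕ)} (𝒯 : Set (Finset (Fin n → ℕ))) (β : A → ℝ) : Prop :=
  ∀ T ∈ 𝒯, ∃ (u : Fin n → ℝ) (c : ℝ), ∀ a : A,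
    u ⬝ᵥ toReal a.1 + β a ≤ c ∧ (u ⬝ᵥ toReal a.1 + β a = c ↔ a.1 ∈ T)

theorem IsUnimodular.nonempty {n : ℕ} {T : Finset (Fin n → ℕ)} (hT : IsUnimodular T) :
    T.Nonempty := by
  rw [← Finset.card_pos, hT.1]; omega

theorem IsUnimodularCover.nonempty_points {n : ℕ} {A : Finset (Fin n → ℕ)}
    {𝒯 : Set (Finset (Fin n → ℕ))} (h : IsUnimodularCover A 𝒯) : A.Nonempty := by
  obtain ⟨T, hT⟩ := h.nonempty
  exact (h.unimodular T hT).nonempty.mono (h.subset T hT)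

theorem mem_markAt_iff_of_max {n : ℕ} {A : Finset (Fin n → ℕ)} {β : A → ℝ} {u : Fin n → ℝ} {c : ℝ}
    (hle : ∀ a : A, u ⬝ᵥ toReal a.1 + β a ≤ c) {a₀ : A} (h₀ : u ⬝ᵥ toReal a₀.1 + β a₀ = c) {a : A} :
    a ∈ markAt A β u ↔ u ⬝ᵥ toReal a.1 + β a = c := by
  constructor
  · intro ha
    exact le_antisymm (hle a) (h₀ ▸ ha a₀)
  · intro ha b
    rw [ha]; exact hle b

/-- The right-hand side does not involve `β`: all lifts of `𝒯` induce the same marked subdivision.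
-/
theorem IsUnimodularCover.markedSubdivision_eq {n : ℕ} {A : Finset (Fin n → ℕ)}
    {𝒯 : Set (Finset (Fin n → ℕ))} (h : IsUnimodularCover A 𝒯) {β : A → ℝ} (hβ : IsLiftOf 𝒯 β) :
    markedSubdivision A β = {M | M.Nonempty ∧ ∃ T ∈ 𝒯, ∀ a ∈ M, a.1 ∈ T} := by
  ext M
  constructor
  · rintro ⟨u, hM⟩
    change M = markAt A β u at hM
    obtain ⟨a₀, ha₀⟩ := markAt_nonempty h.nonempty_points β u
    subst hM
    refine ⟨⟨a₀, ha₀⟩, ?_⟩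
    have hfin : (markAt A β u).Finite := Set.toFinite _
    set F := hfin.toFinset with hF
    have hFne : F.Nonempty := ⟨a₀, by simpa [hF] using ha₀⟩
    have hFpos : (0 : ℝ) < F.card := by exact_mod_cast hFne.card_pos
    -- The barycentre of the marked points lies in some simplex of the cover. There `v - u` is at
    -- least `K`, whereas at each marked point it is at most `K`. Equality must hold at every marked
    -- point, so all of them are vertices of that simplex.
    set x : Fin n → ℝ := ∑ a ∈ F, (F.card : ℝ)⁻¹ • toReal a.1 with hx
    have hxmem : x ∈ convexHull ℝ (toReal '' (A : Set (Fin n → ℕ))) := by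
      refine (convex_convexHull ℝ _).sum_mem (fun _ _ => by positivity) ?_ fun a _ =>
        subset_convexHull ℝ _ ⟨a.1, a.2, rfl⟩
      rw [Finset.sum_const, nsmul_eq_mul, mul_inv_cancel₀ hFpos.ne']
    obtain ⟨T, hT, hxT⟩ := h.cover x hxmem
    refine ⟨T, hT, ?_⟩
    obtain ⟨v, c, hv⟩ := hβ T hT
    set K : ℝ := c - (u ⬝ᵥ toReal a₀.1 + β a₀) with hK
    have hxK : K ≤ v ⬝ᵥ x - u ⬝ᵥ x := by
      have h1 : (dotProductBilin ℝ ℝ (u - v)) x ≤ -K := by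
        refine linear_le_on_convexHull ?_ hxT
        rintro _ ⟨t, ht, rfl⟩
        have e1 := (hv ⟨t, h.subset T hT ht⟩).2.2 ht
        have e2 := ha₀ ⟨t, h.subset T hT ht⟩
        change (u - v) ⬝ᵥ toReal t ≤ -K
        simp only at e1 e2
        rw [sub_dotProduct]; linarith
      change (u - v) ⬝ᵥ x ≤ -K at h1
      rw [sub_dotProduct] at h1
      linarith
    have hmem : ∀ a ∈ F, v ⬝ᵥ toReal a.1 - u ⬝ᵥ toReal a.1 ≤ K := by
      intro a ha
      have e1 : a ∈ markAt A β u := by simpa [hF] using ha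
      have e2 := e1 a₀
      have e3 := (hv a).1
      linarith
    have hsum : ∑ a ∈ F, (K - (v ⬝ᵥ toReal a.1 - u ⬝ᵥ toReal a.1)) ≤ 0 := by
      have e : ∀ w : Fin n → ℝ, w ⬝ᵥ x = (F.card : ℝ)⁻¹ * ∑ a ∈ F, w ⬝ᵥ toReal a.1 := by
        intro w
        rw [hx, dotProduct_sum, Finset.mul_sum]
        simp only [dotProduct_smul, smul_eq_mul]
      rw [e, e, ← mul_sub, ← Finset.sum_sub_distrib, inv_mul_eq_div, le_div_iff₀ hFpos] at hxK
      rw [Finset.sum_sub_distrib, Finset.sum_const, nsmul_eq_mul]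
      linarith
    have hzero := (Finset.sum_eq_zero_iff_of_nonneg fun a ha => sub_nonneg.2 (hmem a ha)).1
      (le_antisymm hsum (Finset.sum_nonneg fun a ha => sub_nonneg.2 (hmem a ha)))
    intro a ha
    have e1 := hzero a (by simpa [hF] using ha)
    rw [← (hv a).2]
    have e2 := ha a₀
    have e3 := (hv a).1
    linarith
  · rintro ⟨⟨a₀, ha₀⟩, T, hT, hMT⟩
    classical
    obtain ⟨u, c, hu⟩ := hβ T hT
    -- Tilting the support of `T` slightly in this direction keeps `M` maximal, lowers the other
    -- vertices of `T`, and leaves points outside `T` strictly below.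
    obtain ⟨w, d, hw⟩ := (h.unimodular T hT).exists_affine fun a =>
      if a ∈ Subtype.val '' M then 0 else -1
    have hev : ∀ᶠ ε in 𝓝[>] (0 : ℝ), ∀ a : A, a.1 ∉ T →
        0 < (c - (u ⬝ᵥ toReal a.1 + β a)) + ε * (-(w ⬝ᵥ toReal a.1 + d)) := by
      rw [Filter.eventually_all]
      intro a
      by_cases haT : a.1 ∈ T
      · simp [haT]
      · simp only [haT, not_false_eq_true, forall_const]
        exact eventually_add_mul_pos (sub_pos.2 (lt_of_le_of_ne (hu a).1 fun he =>
          haT ((hu a).2.1 he)))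
    obtain ⟨ε, hε, hε0⟩ := (hev.and self_mem_nhdsWithin).exists
    have key : ∀ a : A, (u + ε • w) ⬝ᵥ toReal a.1 + β a ≤ c - ε * d ∧
        ((u + ε • w) ⬝ᵥ toReal a.1 + β a = c - ε * d ↔ a ∈ M) := by
      intro a
      rw [add_dotProduct, smul_dotProduct, smul_eq_mul]
      by_cases haT : a.1 ∈ T
      · have e1 := (hu a).2.2 haT
        have e2 := hw a.1 haT
        by_cases haM : a ∈ M
        · rw [if_pos ⟨a, haM, rfl⟩] at e2
          have e3 : u ⬝ᵥ toReal a.1 + ε * w ⬝ᵥ toReal a.1 + β a = c - ε * d := by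
            linear_combination e1 + ε * e2
          exact ⟨e3.le, fun _ => haM, fun _ => e3⟩
        · rw [if_neg (by simpa using haM)] at e2
          have e3 : u ⬝ᵥ toReal a.1 + ε * w ⬝ᵥ toReal a.1 + β a = c - ε * d - ε := by
            linear_combination e1 + ε * e2
          exact ⟨by linarith, fun he => by linarith, fun hm => absurd hm haM⟩
      · have e1 := hε a haT
        exact ⟨by linarith, fun he => by linarith, fun hm => absurd (hMT a hm) haT⟩
    refine ⟨u + ε • w, ?_⟩
    ext a
    rw [← (key a).2]
    exact (mem_markAt_iff_of_max (fun a => (key a).1) ((key a₀).2.2 ha₀)).symm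

/-- An exposed face of a cell is the hull of some of its marked points, and every nonempty subset of
a marked set is again marked by `IsUnimodularCover.markedSubdivision_eq`. Intersections are handled
by `isExposed_inter`, and the union by the covering property. -/
theorem isSubdivision_inducedSubdivision {n : ℕ} {A : Finset (Fin n → ℕ)}
    {𝒯 : Set (Finset (Fin n → ℕ))} (h : IsUnimodularCover A 𝒯) {β : A → ℝ} (hβ : IsLiftOf 𝒯 β) :
    IsSubdivision (convexHull ℝ (toReal '' (A : Set (Fin n → ℕ)))) (inducedSubdivision A β) := by
  classical
  rw [inducedSubdivision_eq]
  refine ⟨((Set.toFinite _).image _).insert _, ?_, ?_, ?_, ?_⟩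
  · rintro C (rfl | ⟨M, -, rfl⟩)
    · exact ⟨∅, by simp⟩
    · refine ⟨(Set.toFinite (toReal '' (Subtype.val '' M))).toFinset, ?_⟩
      rw [Set.Finite.coe_toFinset]; rfl
  · intro C hC F hF
    rcases F.eq_empty_or_nonempty with rfl | hne
    · exact Set.mem_insert _ _
    obtain ⟨l, hl⟩ := hF hne
    rcases hC with rfl | ⟨M, hM, rfl⟩
    · obtain ⟨x, hx⟩ := hne
      rw [hl] at hx
      exact hx.1.elim
    right
    have hface := maximisers_convexHull (Set.toFinite (toReal '' (Subtype.val '' M))) l.toLinearMap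
    rw [cellOf] at hl
    simp only [ContinuousLinearMap.coe_coe] at hface
    rw [hface] at hl
    have hset : {v ∈ toReal '' (Subtype.val '' M) | ∀ w ∈ toReal '' (Subtype.val '' M), l w ≤ l v} =
        toReal '' (Subtype.val '' {a ∈ M | ∀ b ∈ M, l (toReal b.1) ≤ l (toReal a.1)}) := by
      ext x
      constructor
      · rintro ⟨⟨_, ⟨a, ha, rfl⟩, rfl⟩, hx⟩
        exact ⟨_, ⟨a, ⟨ha, fun b hb => hx _ ⟨_, ⟨b, hb, rfl⟩, rfl⟩⟩, rfl⟩, rfl⟩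
      · rintro ⟨_, ⟨a, ⟨ha, hx⟩, rfl⟩, rfl⟩
        refine ⟨⟨_, ⟨a, ha, rfl⟩, rfl⟩, ?_⟩
        rintro _ ⟨_, ⟨b, hb, rfl⟩, rfl⟩
        exact hx b hb
    rw [hset] at hl
    refine ⟨{a ∈ M | ∀ b ∈ M, l (toReal b.1) ≤ l (toReal a.1)}, ?_, hl.symm⟩
    rw [h.markedSubdivision_eq hβ] at hM ⊢
    obtain ⟨-, T, hT, hMT⟩ := hM
    refine ⟨?_, T, hT, fun a ha => hMT a ha.1⟩
    rw [hl, convexHull_nonempty_iff] at hne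
    simpa using hne
  · rintro C (rfl | ⟨_, ⟨u, rfl⟩, rfl⟩) C' (rfl | ⟨_, ⟨v, rfl⟩, rfl⟩)
    · simp [isExposed_empty]
    · simp [isExposed_empty]
    · simp [isExposed_empty]
    · exact ⟨isExposed_inter β u v, Set.inter_comm _ _ ▸ isExposed_inter β v u⟩
  · apply Set.Subset.antisymm
    · apply Set.sUnion_subset
      rintro C (rfl | ⟨M, -, rfl⟩)
      · exact Set.empty_subset _
      · refine convexHull_mono (Set.image_mono ?_)
        rintro _ ⟨a, -, rfl⟩
        exact a.2
    · intro x hx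
      obtain ⟨T, hT, hxT⟩ := h.cover x hx
      refine ⟨cellOf {a : A | a.1 ∈ T}, Or.inr ⟨_, ?_, rfl⟩, ?_⟩
      · rw [h.markedSubdivision_eq hβ]
        obtain ⟨t, ht⟩ := (h.unimodular T hT).nonempty
        exact ⟨⟨⟨t, h.subset T hT ht⟩, ht⟩, T, hT, fun a ha => ha⟩
      · refine convexHull_mono (Set.image_mono ?_) hxT
        exact fun t ht => ⟨⟨t, h.subset T hT ht⟩, ht, rfl⟩

theorem image_val_mem {n : ℕ} {A T : Finset (Fin n → ℕ)} (h : T ⊆ A) :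
    Subtype.val '' {a : A | a.1 ∈ T} = (T : Set (Fin n → ℕ)) := by
  ext t
  exact ⟨fun ⟨a, ha, e⟩ => e ▸ ha, fun ht => ⟨⟨t, h ht⟩, ht, rfl⟩⟩

theorem IsUnimodularCover.cell_mem {n : ℕ} {A : Finset (Fin n → ℕ)}
    {𝒯 : Set (Finset (Fin n → ℕ))} (h : IsUnimodularCover A 𝒯) {β : A → ℝ} (hβ : IsLiftOf 𝒯 β)
    {T : Finset (Fin n → ℕ)} (hT : T ∈ 𝒯) :
    convexHull ℝ (toReal '' (T : Set (Fin n → ℕ))) ∈ inducedSubdivision A β := by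
  rw [inducedSubdivision_eq, h.markedSubdivision_eq hβ]
  obtain ⟨t, ht⟩ := (h.unimodular T hT).nonempty
  refine Or.inr ⟨{a : A | a.1 ∈ T}, ⟨⟨⟨t, h.subset T hT ht⟩, ht⟩, T, hT, fun a ha => ha⟩, ?_⟩
  rw [cellOf, image_val_mem (h.subset T hT)]

theorem IsUnimodularCover.eq_of_maximal {n : ℕ} {A : Finset (Fin n → ℕ)}
    {𝒯 : Set (Finset (Fin n → ℕ))} (h : IsUnimodularCover A 𝒯) {β : A → ℝ} (hβ : IsLiftOf 𝒯 β)
    {C : Set (Fin n → ℝ)} (hC : Maximal (· ∈ inducedSubdivision A β) C) :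
    ∃ T ∈ 𝒯, C = convexHull ℝ (toReal '' (T : Set (Fin n → ℕ))) := by
  obtain ⟨T, hT, hsub⟩ : ∃ T ∈ 𝒯, C ⊆ convexHull ℝ (toReal '' (T : Set (Fin n → ℕ))) := by
    have hC1 := hC.prop
    rw [inducedSubdivision_eq, h.markedSubdivision_eq hβ] at hC1
    rcases hC1 with rfl | ⟨M, ⟨-, T, hT, hMT⟩, rfl⟩
    · obtain ⟨T, hT⟩ := h.nonempty
      exact ⟨T, hT, Set.empty_subset _⟩
    · refine ⟨T, hT, convexHull_mono (Set.image_mono ?_)⟩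
      rintro _ ⟨a, ha, rfl⟩
      exact hMT a ha
  exact ⟨T, hT, hC.eq_of_le (h.cell_mem hβ hT) hsub⟩

theorem IsUnimodularCover.isLiftOf_of_marked {n : ℕ} {A : Finset (Fin n → ℕ)}
    {𝒯 : Set (Finset (Fin n → ℕ))} (h : IsUnimodularCover A 𝒯) {β : A → ℝ}
    (hm : ∀ T ∈ 𝒯, {a : A | a.1 ∈ T} ∈ markedSubdivision A β) : IsLiftOf 𝒯 β := by
  intro T hT
  obtain ⟨u, hu⟩ := hm T hT
  obtain ⟨t, ht⟩ := (h.unimodular T hT).nonempty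
  change _ = markAt A β u at hu
  set s : A := ⟨t, h.subset T hT ht⟩ with hs
  have hsm : s ∈ markAt A β u := hu ▸ ht
  refine ⟨u, u ⬝ᵥ toReal s.1 + β s, fun a => ⟨hsm a, ?_⟩⟩
  rw [← mem_markAt_iff_of_max hsm rfl, ← hu]
  rfl

theorem IsUnimodularCover.setOf_marked_eq {n : ℕ} {A : Finset (Fin n → ℕ)}
    {𝒯 : Set (Finset (Fin n → ℕ))} (h : IsUnimodularCover A 𝒯) {α : A → ℝ} (hα : IsLiftOf 𝒯 α) :
    {β | markedSubdivision A β = markedSubdivision A α} = {β | IsLiftOf 𝒯 β} := by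
  ext β
  constructor
  · intro hβ
    refine h.isLiftOf_of_marked fun T hT => ?_
    rw [hβ, h.markedSubdivision_eq hα]
    obtain ⟨t, ht⟩ := (h.unimodular T hT).nonempty
    exact ⟨⟨⟨t, h.subset T hT ht⟩, ht⟩, T, hT, fun a ha => ha⟩
  · intro hβ
    exact (h.markedSubdivision_eq hβ).trans (h.markedSubdivision_eq hα).symm

/-- The unmarked subdivision already determines the lifts: a marked set whose hull is a unimodular
simplex can only be its vertex set. -/
theorem IsUnimodularCover.inducingLifts_eq {n : ℕ} {A : Finset (Fin n → ℕ)}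
    {𝒯 : Set (Finset (Fin n → ℕ))} (h : IsUnimodularCover A 𝒯) {α : A → ℝ} (hα : IsLiftOf 𝒯 α) :
    inducingLifts A (inducedSubdivision A α) = {β | IsLiftOf 𝒯 β} := by
  ext β
  constructor
  · intro hβ
    refine h.isLiftOf_of_marked fun T hT => ?_
    have hmem := h.cell_mem hα hT
    rw [← show inducedSubdivision A β = _ from hβ, inducedSubdivision_eq] at hmem
    obtain ⟨t, ht⟩ := (h.unimodular T hT).nonempty
    rcases hmem with he | ⟨M, hM, he⟩
    · have hmem := subset_convexHull ℝ _ (Set.mem_image_of_mem toReal (Finset.mem_coe.2 ht))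
      rw [he] at hmem
      exact hmem.elim
    · have := (h.unimodular T hT).eq_of_convexHull_eq he
      rw [← image_val_mem (h.subset T hT)] at this
      rwa [← Subtype.val_injective.image_injective this]
  · intro hβ
    change inducedSubdivision A β = _
    rw [inducedSubdivision_eq, inducedSubdivision_eq, h.markedSubdivision_eq hβ,
      h.markedSubdivision_eq hα]

/-! ### The cone of lifts -/

/-- `L β` measures how far the lift of `a` lies below the affine interpolation of `β` on `T`. It is
linear in `β`, with the barycentric coordinates of `a` with respect to `T` as coefficients. -/
theorem IsUnimodular.exists_dual {n : ℕ} {A T : Finset (Fin n → ℕ)} (hTA : T ⊆ A)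
    (hT : IsUnimodular T) (a : A) : ∃ L : Module.Dual ℝ (A → ℝ), ∀ (β : A → ℝ) (u : Fin n → ℝ)
      (c : ℝ), (∀ t : A, t.1 ∈ T → u ⬝ᵥ toReal t.1 + β t = c) →
        L β = c - (u ⬝ᵥ toReal a.1 + β a) := by
  classical
  choose w d h using fun s : Fin n → ℕ => hT.exists_affine fun t => if t = s then 1 else 0
  refine ⟨∑ s : T, (w s.1 ⬝ᵥ toReal a.1 + d s.1) • LinearMap.proj (⟨s.1, hTA s.2⟩ : A) -
    LinearMap.proj a, fun β u c hβ => ?_⟩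
  simp only [LinearMap.sub_apply, LinearMap.sum_apply, LinearMap.smul_apply, LinearMap.proj_apply,
    smul_eq_mul]
  set φ : T → ℝ := fun s => β ⟨s.1, hTA s.2⟩ with hφ
  have key := hT.affine_eq_zero (v := ∑ s : T, φ s • w s.1 + u) (d := ∑ s : T, φ s * d s.1 - c)
    (by
      intro t ht
      have e1 := hβ ⟨t, hTA ht⟩ ht
      have e2 : ∑ s : T, φ s * (w s.1 ⬝ᵥ toReal t + d s.1) = φ ⟨t, ht⟩ := by
        rw [Finset.sum_eq_single ⟨t, ht⟩]
        · rw [h t t ht, if_pos rfl, mul_one]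
        · intro s _ hs
          rw [h s.1 t ht, if_neg fun e => hs (Subtype.ext e.symm), mul_zero]
        · simp
      rw [add_dotProduct, sum_dotProduct]
      simp only [smul_dotProduct, smul_eq_mul, mul_add, Finset.sum_add_distrib] at e2 ⊢
      simp only [hφ] at e2 ⊢
      linarith) (toReal a.1)
  rw [add_dotProduct, sum_dotProduct] at key
  simp only [smul_dotProduct, smul_eq_mul] at key
  have e3 : ∑ s : T, (w s.1 ⬝ᵥ toReal a.1 + d s.1) * φ s =
      ∑ s : T, φ s * w s.1 ⬝ᵥ toReal a.1 + ∑ s : T, φ s * d s.1 := by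
    rw [← Finset.sum_add_distrib]
    exact Finset.sum_congr rfl fun s _ => by ring
  linarith

/-- Over each `T` the affine interpolation of `β` is the candidate support, so `β` is a lift exactly
when all slacks at points outside `T` are positive, for every `T`. -/
theorem IsUnimodularCover.exists_duals {n : ℕ} {A : Finset (Fin n → ℕ)}
    {𝒯 : Set (Finset (Fin n → ℕ))} (h : IsUnimodularCover A 𝒯) :
    ∃ H : Finset (Module.Dual ℝ (A → ℝ)), ∀ β : A → ℝ, IsLiftOf 𝒯 β ↔ ∀ L ∈ H, 0 < L β := by
  classical
  have hfin : 𝒯.Finite := (Finset.finite_toSet A.powerset).subset fun T hT => by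
    simpa using h.subset T hT
  have hd : ∀ (T : 𝒯) (a : A), ∃ L : Module.Dual ℝ (A → ℝ), ∀ (β : A → ℝ) (u : Fin n → ℝ)
      (c : ℝ), (∀ t : A, t.1 ∈ T.1 → u ⬝ᵥ toReal t.1 + β t = c) →
        L β = c - (u ⬝ᵥ toReal a.1 + β a) :=
    fun T a => (h.unimodular T.1 T.2).exists_dual (h.subset T.1 T.2) a
  choose L hL using hd
  have := hfin.to_subtype
  set P : Set (Module.Dual ℝ (A → ℝ)) := {l | ∃ (T : 𝒯) (a : A), a.1 ∉ T.1 ∧ l = L T a} with hP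
  have hPfin : P.Finite := by
    refine (Set.finite_range fun q : 𝒯 × A => L q.1 q.2).subset ?_
    rintro _ ⟨T, a, -, rfl⟩
    exact ⟨(T, a), rfl⟩
  refine ⟨hPfin.toFinset, fun β => ?_⟩
  simp only [Set.Finite.mem_toFinset]
  constructor
  · rintro hβ _ ⟨T, a, ha, rfl⟩
    obtain ⟨u, c, hu⟩ := hβ T.1 T.2
    rw [hL T a β u c fun t ht => (hu t).2.2 ht]
    exact sub_pos.2 (lt_of_le_of_ne (hu a).1 fun he => ha ((hu a).2.1 he))
  · intro hβ T hT
    obtain ⟨w, c, hw⟩ := (h.unimodular T hT).exists_affine fun t =>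
      if ht : t ∈ A then β ⟨t, ht⟩ else 0
    have hc : ∀ t : A, t.1 ∈ T → (-w) ⬝ᵥ toReal t.1 + β t = c := by
      intro t ht
      have := hw t.1 ht
      rw [dif_pos t.2] at this
      rw [neg_dotProduct]
      linarith
    refine ⟨-w, c, fun a => ?_⟩
    by_cases ha : a.1 ∈ T
    · exact ⟨(hc a ha).le, fun _ => ha, fun _ => hc a ha⟩
    · have := hβ _ ⟨⟨T, hT⟩, a, ha, rfl⟩
      rw [hL ⟨T, hT⟩ a β (-w) c hc] at this
      exact ⟨by linarith, fun he => by linarith, fun he => absurd he ha⟩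

theorem closure_openCone {V : Type*} [NormedAddCommGroup V] [NormedSpace ℝ V]
    [FiniteDimensional ℝ V] (H : Finset (Module.Dual ℝ V)) {v₀ : V} (hv₀ : ∀ L ∈ H, 0 < L v₀) :
    closure {v | ∀ L ∈ H, 0 < L v} = {v | ∀ L ∈ H, 0 ≤ L v} := by
  apply Set.Subset.antisymm
  · refine closure_minimal (fun v hv L hL => (hv L hL).le) ?_
    simp only [Set.ofPred_forall]
    exact isClosed_biInter fun L _ =>
      isClosed_le continuous_const L.continuous_of_finiteDimensional
  · intro v hv
    have ht : Tendsto (fun ε : ℝ => v + ε • v₀) (𝓝[>] 0) (𝓝 (v + (0 : ℝ) • v₀)) :=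
      (Continuous.tendsto (by fun_prop) 0).mono_left nhdsWithin_le_nhds
    rw [zero_smul, add_zero] at ht
    refine mem_closure_of_tendsto ht ?_
    filter_upwards [self_mem_nhdsWithin] with ε hε L hL
    rw [map_add, map_smul, smul_eq_mul]
    exact add_pos_of_nonneg_of_pos (hv L hL) (mul_pos hε (hv₀ L hL))

theorem interior_closedCone {V : Type*} [NormedAddCommGroup V] [NormedSpace ℝ V]
    [FiniteDimensional ℝ V] (H : Finset (Module.Dual ℝ V)) {v₀ : V} (hv₀ : ∀ L ∈ H, 0 < L v₀) :
    interior {v | ∀ L ∈ H, 0 ≤ L v} = {v | ∀ L ∈ H, 0 < L v} := by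
  apply Set.Subset.antisymm
  · intro v hv L hL
    have ht : Tendsto (fun ε : ℝ => v - ε • v₀) (𝓝[>] 0) (𝓝 (v - (0 : ℝ) • v₀)) :=
      (Continuous.tendsto (by fun_prop) 0).mono_left nhdsWithin_le_nhds
    rw [zero_smul, sub_zero] at ht
    obtain ⟨ε, hε, hε0⟩ :=
      ((ht.eventually (mem_interior_iff_mem_nhds.1 hv)).and self_mem_nhdsWithin).exists
    have := hε L hL
    rw [map_sub, map_smul, smul_eq_mul] at this
    have := mul_pos (Set.mem_Ioi.1 hε0) (hv₀ L hL)
    linarith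
  · refine interior_maximal (fun v hv L hL => (hv L hL).le) ?_
    simp only [Set.ofPred_forall]
    exact isOpen_biInter_finset fun L _ =>
      isOpen_lt continuous_const L.continuous_of_finiteDimensional

/-! ### Volumes of unimodular simplices -/

/-- The corner simplex of size `r` in `ℝⁿ`. -/
def corner (n : ℕ) (r : ℝ) : Set (Fin n → ℝ) := {x | (∀ i, 0 ≤ x i) ∧ ∑ i, x i ≤ r}

theorem isClosed_corner (n : ℕ) (r : ℝ) : IsClosed (corner n r) := by
  refine IsClosed.inter (s₁ := {x : Fin n → ℝ | ∀ i, 0 ≤ x i}) (s₂ := {x | ∑ i, x i ≤ r}) ?_ ?_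
  · simp only [Set.ofPred_forall]
    exact isClosed_iInter fun i => isClosed_le continuous_const (continuous_apply i)
  · exact isClosed_le (by fun_prop) continuous_const

/-- The slice at height t is a corner simplex of size r - t in one dimension less. -/
theorem volume_corner (n : ℕ) : ∀ {r : ℝ}, 0 ≤ r →
    volume (corner n r) = ENNReal.ofReal (r ^ n / n.factorial) := by
  induction n with
  | zero =>
    intro r hr
    have : corner 0 r = Set.univ := by
      ext x; simp [corner, hr]
    rw [this, volume_pi, Measure.pi_of_empty]
    simp
  | succ n ih =>
    intro r hr
    have hmp := volume_preserving_piFinSuccAbove (fun _ : Fin (n + 1) => ℝ) 0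
    set S : Set (ℝ × (Fin n → ℝ)) := {q | 0 ≤ q.1 ∧ (∀ i, 0 ≤ q.2 i) ∧ q.1 + ∑ i, q.2 i ≤ r} with hS
    have hpre : corner (n + 1) r =
        (MeasurableEquiv.piFinSuccAbove (fun _ : Fin (n + 1) => ℝ) 0) ⁻¹' S := by
      ext x
      simp [corner, hS, Fin.forall_fin_succ, Fin.sum_univ_succ, and_assoc, Fin.tail]
    have hSm : MeasurableSet S := by
      have : MeasurableSet ((MeasurableEquiv.piFinSuccAbove (fun _ : Fin (n + 1) => ℝ) 0) ⁻¹' S) :=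
        hpre ▸ (isClosed_corner (n + 1) r).measurableSet
      exact (MeasurableEquiv.measurableSet_preimage _).1 this
    rw [hpre, hmp.measure_preimage hSm.nullMeasurableSet, Measure.volume_eq_prod,
      Measure.prod_apply hSm]
    have hslice : ∀ t : ℝ, volume (Prod.mk t ⁻¹' S) =
        (Set.Icc 0 r).indicator (fun t => ENNReal.ofReal ((r - t) ^ n / n.factorial)) t := by
      intro t
      by_cases ht : t ∈ Set.Icc 0 r
      · rw [Set.indicator_of_mem ht, ← ih (sub_nonneg.2 ht.2)]
        congr 1
        ext y
        simp only [hS, corner, Set.mem_preimage, Set.mem_ofPred_eq, ht.1, true_and]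
        exact and_congr_right fun _ => by rw [le_sub_iff_add_le, add_comm]
      · rw [Set.indicator_of_notMem ht]
        have : Prod.mk t ⁻¹' S = ∅ := by
          refine Set.eq_empty_iff_forall_notMem.2 fun y hy => ht ⟨hy.1, ?_⟩
          have h1 := hy.2.2
          have h2 : 0 ≤ ∑ i, y i := Finset.sum_nonneg fun i _ => hy.2.1 i
          simp only at h1
          linarith
        rw [this, measure_empty]
    simp only [hslice]
    rw [lintegral_indicator measurableSet_Icc, ← ofReal_integral_eq_lintegral_ofReal]
    · congr 1
      rw [integral_Icc_eq_integral_Ioc, ← intervalIntegral.integral_of_le hr,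
        intervalIntegral.integral_div,
        intervalIntegral.integral_comp_sub_left (fun t => t ^ n) r]
      simp only [sub_self, sub_zero, integral_pow, Nat.factorial_succ]
      push_cast
      have : (n.factorial : ℝ) ≠ 0 := by positivity
      have : (n : ℝ) + 1 ≠ 0 := by positivity
      field_simp
      simp
    · exact ContinuousOn.integrableOn_Icc (by fun_prop)
    · filter_upwards [ae_restrict_mem measurableSet_Icc] with t ht
      have := sub_nonneg.2 ht.2
      positivity

theorem IsUnimodular.volume_convexHull {n : ℕ} {T : Finset (Fin n → ℕ)} (hT : IsUnimodular T) :
    volume (convexHull ℝ (toReal '' (T : Set (Fin n → ℕ)))) = (n.factorial : ENNReal)⁻¹ := by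
  classical
  let e : Fin (n + 1) ≃ T := (T.equivFinOfCardEq hT.1).symm
  set M : Matrix (Fin n) (Fin n) ℤ :=
    Matrix.of fun i j => ((e j.succ).1 i : ℤ) - ((e 0).1 i : ℤ) with hM
  have hdet : |M.det| = 1 := by
    choose w c hw using fun k : Fin n => hT.exists_indicator (e k.succ).1
    -- The linear parts of the integral indicator functions form an integral left inverse of the
    -- edge matrix, so its determinant is a unit of ℤ.
    have hWM : (Matrix.of w) * M = 1 := by
      ext k j
      have h1 := hw k _ (e j.succ).2
      have h2 := hw k _ (e 0).2
      rw [if_neg (by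
        rw [Subtype.coe_inj, e.apply_eq_iff_eq]
        exact (Fin.succ_ne_zero k).symm)] at h2
      simp only [Subtype.coe_inj, e.apply_eq_iff_eq, Fin.succ_inj] at h1
      simp only [Matrix.mul_apply, Matrix.of_apply, hM, mul_sub, Finset.sum_sub_distrib,
        Matrix.one_apply]
      simp only [eq_comm (a := k)]
      linarith
    have := congrArg Matrix.det hWM
    rw [Matrix.det_mul, Matrix.det_one] at this
    exact Int.isUnit_iff_abs_eq.1 (IsUnit.of_mul_eq_one _ (by rw [mul_comm]; exact this))
  set f : (Fin n → ℝ) →ₗ[ℝ] (Fin n → ℝ) := Matrix.toLin' (M.map (Int.cast : ℤ → ℝ)) with hf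
  have hfx : ∀ (y : Fin n → ℝ) i, f y i =
      ∑ j, (((e j.succ).1 i : ℝ) - ((e 0).1 i : ℝ)) * y j := by
    intro y i
    simp [hf, Matrix.mulVec, dotProduct, hM]
  have hfdet : |LinearMap.det f| = 1 := by
    have hmap : (M.map (Int.cast : ℤ → ℝ)).det = ((M.det : ℤ) : ℝ) :=
      ((Int.castRingHom ℝ).map_det M).symm
    rw [hf, LinearMap.det_toLin', hmap, ← Int.cast_abs, hdet, Int.cast_one]
  have hsumT : ∀ F : (Fin n → ℕ) → ℝ, ∑ t ∈ T, F t = F (e 0).1 + ∑ j : Fin n, F (e j.succ).1 := by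
    intro F
    rw [← Finset.sum_coe_sort T, ← e.sum_comp, Fin.sum_univ_succ]
  -- The simplex is the translated image of the unit corner simplex under the edge matrix, which
  -- preserves volume.
  have himg : convexHull ℝ (toReal '' (T : Set (Fin n → ℕ))) =
      (fun x => toReal (e 0).1 + x) '' (f '' corner n 1) := by
    ext x
    rw [mem_convexHull_toReal]
    constructor
    · rintro ⟨l, h0, h1, h2⟩
      rw [hsumT] at h1
      refine ⟨f (fun j => l (e j.succ).1), ⟨_, ⟨fun j => h0 _ (e j.succ).2, ?_⟩, rfl⟩, ?_⟩
      · have := h0 _ (e 0).2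
        linarith
      · ext i
        have h3 := congrFun h2 i
        simp only [Finset.sum_apply, Pi.smul_apply, smul_eq_mul, toReal] at h3
        rw [hsumT fun t => l t * (t i : ℝ)] at h3
        simp only [Pi.add_apply, hfx, toReal, sub_mul, Finset.sum_sub_distrib, ← Finset.mul_sum]
        simp only [mul_comm] at h3 ⊢
        linear_combination h3 - ((e 0).1 i : ℝ) * h1
    · rintro ⟨_, ⟨y, ⟨hy0, hy1⟩, rfl⟩, rfl⟩
      set l : (Fin n → ℕ) → ℝ := fun t =>
        if ht : t ∈ T then (Fin.cons (1 - ∑ j, y j) y : Fin (n + 1) → ℝ) (e.symm ⟨t, ht⟩) else 0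
        with hl
      have hle : ∀ k, l (e k).1 = (Fin.cons (1 - ∑ j, y j) y : Fin (n + 1) → ℝ) k := by
        intro k
        simp [hl]
      have hl0 : l (e 0).1 = 1 - ∑ j, y j := hle 0
      have hls : ∀ j : Fin n, l (e j.succ).1 = y j := fun j => hle j.succ
      refine ⟨l, ?_, ?_, ?_⟩
      · intro t ht
        obtain ⟨k, hk⟩ := e.surjective ⟨t, ht⟩
        have : t = (e k).1 := by rw [hk]
        rw [this]
        refine Fin.cases ?_ (fun j => ?_) k
        · rw [hl0]; linarith
        · rw [hls]; exact hy0 j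
      · rw [hsumT, hl0]
        simp only [hls]
        ring
      · ext i
        simp only [Finset.sum_apply, Pi.smul_apply, smul_eq_mul, toReal, Pi.add_apply, hfx]
        rw [hsumT fun t => l t * (t i : ℝ), hl0]
        simp only [hls, sub_mul, Finset.sum_sub_distrib, ← Finset.mul_sum]
        simp only [mul_comm]
        ring
  rw [himg, Set.image_add_left, measure_preimage_add, Measure.addHaar_image_linearMap, hfdet,
    volume_corner n zero_le_one, ENNReal.ofReal_one, one_mul, one_pow, one_div,
    ENNReal.ofReal_inv_of_pos (by positivity), ENNReal.ofReal_natCast]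

theorem isLatticePolytope_convexHull {n : ℕ} {M : Set (Fin n → ℕ)} (hM : M.Finite) :
    IsLatticePolytope (convexHull ℝ (toReal '' M)) := by
  classical
  refine ⟨(hM.image fun a i => (a i : ℤ)).toFinset, ?_⟩
  rw [Set.Finite.coe_toFinset, Set.image_image]
  rfl

theorem IsUnimodular.isElementary {n : ℕ} {T : Finset (Fin n → ℕ)} (hT : IsUnimodular T) :
    IsElementary (convexHull ℝ (toReal '' (T : Set (Fin n → ℕ)))) :=
  ⟨isLatticePolytope_convexHull T.finite_toSet,
    by rw [affineSpan_convexHull, hT.affineSpan_eq_top], hT.volume_convexHull⟩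

theorem IsUnimodular.isSimplex {n : ℕ} {T : Finset (Fin n → ℕ)} (hT : IsUnimodular T) :
    IsSimplex (convexHull ℝ (toReal '' (T : Set (Fin n → ℕ)))) := by
  let e : Fin (n + 1) ≃ T := (T.equivFinOfCardEq hT.1).symm
  refine ⟨n, fun k => toReal (e k).1, hT.affineIndependent.comp_embedding e.toEmbedding, ?_⟩
  congr 1
  ext x
  constructor
  · rintro ⟨t, ht, rfl⟩
    exact ⟨e.symm ⟨t, ht⟩, by simp⟩
  · rintro ⟨k, rfl⟩
    exact ⟨_, (e k).2, rfl⟩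

theorem IsUnimodularCover.isElementaryTriangulation {n : ℕ} {A : Finset (Fin n → ℕ)}
    {𝒯 : Set (Finset (Fin n → ℕ))} (h : IsUnimodularCover A 𝒯) {β : A → ℝ} (hβ : IsLiftOf 𝒯 β) :
    IsElementaryTriangulation (convexHull ℝ (toReal '' (A : Set (Fin n → ℕ))))
      (inducedSubdivision A β) where
  subdivision := isSubdivision_inducedSubdivision h hβ
  lattice C hC := by
    rw [inducedSubdivision_eq] at hC
    rcases hC with rfl | ⟨M, -, rfl⟩
    · exact ⟨∅, by simp⟩
    · exact isLatticePolytope_convexHull (Set.toFinite _)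
  simplex C hC := by
    obtain ⟨T, hT, rfl⟩ := h.eq_of_maximal hβ hC
    exact (h.unimodular T hT).isSimplex
  elementary C hC := by
    obtain ⟨T, hT, rfl⟩ := h.eq_of_maximal hβ hC
    exact (h.unimodular T hT).isElementary

/-! ### The simplex `Γ_δ` -/

theorem gamPoints_eq (δ : ℕ) : gamPoints δ = cornerPoints 3 δ := by
  ext a
  simp only [gamPoints, cornerPoints, Fin.sum_univ_three]

theorem mem_gamPoints {δ : ℕ} {a : Fin 3 → ℕ} : a ∈ gamPoints δ ↔ a 0 + a 1 + a 2 ≤ δ := by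
  rw [gamPoints_eq, mem_cornerPoints, Fin.sum_univ_three]

theorem toReal_vec (x y z : ℕ) : toReal ![x, y, z] = ![(x : ℝ), y, z] := by
  ext j
  fin_cases j <;> rfl

theorem convexHull_gamPoints {δ : ℕ} (hδ : 0 < δ) :
    convexHull ℝ (toReal '' (gamPoints δ : Set (Fin 3 → ℕ))) = Gam δ := by
  have hδ' : (0 : ℝ) < δ := by exact_mod_cast hδ
  apply Set.Subset.antisymm
  · refine convexHull_min ?_ (convex_convexHull ℝ _)
    rintro _ ⟨a, ha, rfl⟩
    have hsum : (a 0 : ℝ) + a 1 + a 2 ≤ δ := by exact_mod_cast mem_gamPoints.1 ha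
    have key : toReal a = ∑ k : Fin 4,
        (![1 - ((a 0 : ℝ) + a 1 + a 2) / δ, a 0 / δ, a 1 / δ, a 2 / δ] : Fin 4 → ℝ) k •
        (![![0, 0, 0], ![(δ : ℝ), 0, 0], ![0, (δ : ℝ), 0], ![0, 0, (δ : ℝ)]] :
          Fin 4 → Fin 3 → ℝ) k := by
      ext j
      fin_cases j <;> simp [Fin.sum_univ_four, toReal, hδ'.ne']
    rw [key]
    refine (convex_convexHull ℝ _).sum_mem ?_ ?_ ?_
    · intro k _
      have : ((a 0 : ℝ) + a 1 + a 2) / δ ≤ 1 := (div_le_one hδ').2 hsum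
      fin_cases k
      · simpa using this
      · simp; positivity
      · simp; positivity
      · simp; positivity
    · simp only [Fin.sum_univ_four, Matrix.cons_val]
      field_simp
      ring
    · intro k _
      apply subset_convexHull
      fin_cases k <;> simp
  · refine convexHull_mono ?_
    rintro x (rfl | rfl | rfl | rfl)
    · exact ⟨![0, 0, 0], mem_gamPoints.2 (by simp), by simp [toReal_vec]⟩
    · exact ⟨![δ, 0, 0], mem_gamPoints.2 (by simp), by simp [toReal_vec]⟩
    · exact ⟨![0, δ, 0], mem_gamPoints.2 (by simp), by simp [toReal_vec]⟩
    · exact ⟨![0, 0, δ], mem_gamPoints.2 (by simp), by simp [toReal_vec]⟩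

theorem IsCornerTriangulation.isUnimodularCover {n δ : ℕ} {𝒯 : Set (Finset (Fin n → ℕ))}
    (h : IsCornerTriangulation n δ 𝒯) : IsUnimodularCover (cornerPoints n δ) 𝒯 where
  subset := h.subset
  unimodular := h.unimodular
  nonempty := by
    obtain ⟨T, hT, -⟩ := h.cover 0 (fun _ => le_rfl) (by simp)
    exact ⟨T, hT⟩
  cover x hx := by
    obtain ⟨l, h0, h1, rfl⟩ := mem_convexHull_toReal.1 hx
    obtain ⟨T, hT, m, m0, m1, m2⟩ := h.cover (∑ t ∈ cornerPoints n δ, l t • toReal t) (by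
      intro j
      rw [Finset.sum_apply]
      refine Finset.sum_nonneg fun t ht => ?_
      have := h0 t ht
      simp only [Pi.smul_apply, toReal, smul_eq_mul]
      positivity) (by
      simp only [Finset.sum_apply, Pi.smul_apply, toReal, smul_eq_mul]
      rw [Finset.sum_comm]
      calc _ ≤ ∑ t ∈ cornerPoints n δ, l t * δ := by
            refine Finset.sum_le_sum fun t ht => ?_
            rw [← Finset.mul_sum]
            refine mul_le_mul_of_nonneg_left ?_ (h0 t ht)
            exact_mod_cast mem_cornerPoints.1 ht
        _ = δ := by rw [← Finset.sum_mul, h1, one_mul])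
    refine ⟨T, hT, mem_convexHull_toReal.2 ⟨m, m0, m1, ?_⟩⟩
    ext j
    rw [← m2 j, Finset.sum_apply]
    rfl

/-- The vertices of the tetrahedron `Ω_δ`. -/
def omegVertices (δ : ℕ) : Finset (Fin 3 → ℕ) :=
  {![0, 0, 0], ![0, 0, 1], ![δ - 1, 1, 0], ![1, 0, δ - 1]}

theorem convexHull_omegVertices {δ : ℕ} (hδ : 0 < δ) :
    convexHull ℝ (toReal '' (omegVertices δ : Set (Fin 3 → ℕ))) = Omeg δ := by
  simp [omegVertices, Omeg, Set.image_insert_eq, toReal_vec, Nat.cast_sub (Nat.one_le_iff_ne_zero.2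
    hδ.ne')]

/-! ### The two-point family -/

/-- The tropical line with vertices `v` and `v + t (ω₁ + ω₂)`. -/
def pencilLine (v : Fin 3 → ℝ) (t : ℝ) : Set (Fin 3 → ℝ) :=
  segment ℝ v (v + t • (omega 0 + omega 1)) ∪ (ray v 2 ∪ ray v 3) ∪
    (ray (v + t • (omega 0 + omega 1)) 0 ∪ ray (v + t • (omega 0 + omega 1)) 1)

theorem isTropicalLine_pencilLine (v : Fin 3 → ℝ) {t : ℝ} (ht : 0 ≤ t) :
    IsTropicalLine (pencilLine v t) := by
  refine ⟨⟨![2, 3, 0, 1], ![2, 3, 0, 1], by decide, by decide⟩, v, _, omega 0 + omega 1, t, ht, rfl,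
    ?_, ?_, rfl⟩
  · ext j
    fin_cases j <;> simp [omega]
  · simp

theorem mem_pencilLine_iff {v y : Fin 3 → ℝ} {t : ℝ} :
    v + y ∈ pencilLine v t ↔
      (∃ q, 0 ≤ q ∧ q ≤ 1 ∧ y = ![-(q * t), -(q * t), 0]) ∨ (∃ s, 0 ≤ s ∧ y = ![0, 0, -s]) ∨
      (∃ s, 0 ≤ s ∧ y = ![s, s, s]) ∨ (∃ s, 0 ≤ s ∧ y = ![-t - s, -t, 0]) ∨
      (∃ s, 0 ≤ s ∧ y = ![-t, -t - s, 0]) := by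
  have e1 : ∀ q : ℝ, q • t • (omega 0 + omega 1) = ![-(q * t), -(q * t), 0] := by
    intro q; ext j; fin_cases j <;> simp [omega]
  have e2 : ∀ s : ℝ, s • omega 2 = ![0, 0, -s] := by
    intro q; ext j; fin_cases j <;> simp [omega]
  have e3 : ∀ s : ℝ, s • omega 3 = ![s, s, s] := by
    intro q; ext j; fin_cases j <;> simp [omega]
  have e4 : ∀ s : ℝ, t • (omega 0 + omega 1) + s • omega 0 = ![-t - s, -t, 0] := by
    intro q; ext j; fin_cases j <;> simp [omega, sub_eq_add_neg]
  have e5 : ∀ s : ℝ, t • (omega 0 + omega 1) + s • omega 1 = ![-t, -t - s, 0] := by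
    intro q; ext j; fin_cases j <;> simp [omega, sub_eq_add_neg]
  simp only [pencilLine, Set.mem_union, segment_eq_image', Set.mem_image, Set.mem_Icc, ray,
    Set.mem_ofPred_eq, add_sub_cancel_left, add_assoc, add_right_inj, e1, e2, e3, e4, e5, or_assoc,
    and_assoc]
  simp only [eq_comm (b := y)]

theorem pencilLine_injective (v : Fin 3 → ℝ) :
    Function.Injective fun k : ℕ => pencilLine v k := by
  intro k m h
  -- This point on the ray along -e₁ from the second vertex reveals the parameter: it lies off the
  -- diagonal and its second coordinate relative to `v` is -k.
  have hmem : v + ![-(k : ℝ) - 1, -k, 0] ∈ pencilLine v k :=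
    mem_pencilLine_iff.2 (Or.inr (Or.inr (Or.inr (Or.inl ⟨1, zero_le_one, rfl⟩))))
  have hk : (0 : ℝ) ≤ k := Nat.cast_nonneg k
  rw [show pencilLine v k = pencilLine v m from h, mem_pencilLine_iff] at hmem
  have vec : ∀ {a b c a' b' c' : ℝ}, ![a, b, c] = ![a', b', c'] → a = a' ∧ b = b' := by
    intro a b c a' b' c' h
    exact ⟨congrFun h 0, congrFun h 1⟩
  rcases hmem with ⟨q, -, -, e⟩ | ⟨s, hs, e⟩ | ⟨s, hs, e⟩ | ⟨s, hs, e⟩ | ⟨s, hs, e⟩ <;>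
    obtain ⟨e0, e1⟩ := vec e
  · linarith
  · linarith
  · linarith
  · have : (k : ℝ) = m := by linarith
    exact_mod_cast this
  · linarith

theorem pencilLine_subset_hypersurface {δ : ℕ} (hδ : 0 < δ) {α : gamPoints δ → ℝ} {u : Fin 3 → ℝ}
    {c : ℝ} (hle : ∀ a : gamPoints δ, u ⬝ᵥ toReal a.1 + α a ≤ c)
    (heq : ∀ a : gamPoints δ, a.1 ∈ omegVertices δ → u ⬝ᵥ toReal a.1 + α a = c) {t : ℝ}
    (ht : 0 ≤ t) : pencilLine u t ⊆ (polyOfLift δ α).hypersurface := by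
  -- Moving from `u` to `u + y` changes the monomial of exponent d by ⟨d, y⟩. Two vertices of Ω_δ
  -- that both maximise ⟨·, y⟩ over Γ_δ thus remain tied for the maximum.
  have key : ∀ (y : Fin 3 → ℝ) (K : ℝ) (a b : Fin 3 → ℕ), a ≠ b → a ∈ omegVertices δ →
      b ∈ omegVertices δ → a ∈ gamPoints δ → b ∈ gamPoints δ →
      (∀ d ∈ gamPoints δ, toReal d ⬝ᵥ y ≤ K) → toReal a ⬝ᵥ y = K → toReal b ⬝ᵥ y = K →
      u + y ∈ (polyOfLift δ α).hypersurface := by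
    intro y K a b hab haΩ hbΩ ha hb hd haK hbK
    refine ⟨⟨a, ha⟩, ⟨b, hb⟩, fun e => hab (congrArg Subtype.val e), fun d => ?_, fun d => ?_⟩
    · have h1 := hle d
      have h2 := heq ⟨a, ha⟩ haΩ
      have h3 := hd d.1 d.2
      change α d + toReal d.1 ⬝ᵥ (u + y) ≤ α ⟨a, ha⟩ + toReal a ⬝ᵥ (u + y)
      rw [dotProduct_comm u] at h1 h2
      rw [dotProduct_add, dotProduct_add]
      linarith
    · have h1 := hle d
      have h2 := heq ⟨b, hb⟩ hbΩ
      have h3 := hd d.1 d.2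
      change α d + toReal d.1 ⬝ᵥ (u + y) ≤ α ⟨b, hb⟩ + toReal b ⬝ᵥ (u + y)
      rw [dotProduct_comm u] at h1 h2
      rw [dotProduct_add, dotProduct_add]
      linarith
  have m1 : (![0, 0, 0] : Fin 3 → ℕ) ∈ omegVertices δ := by simp [omegVertices]
  have m2 : (![0, 0, 1] : Fin 3 → ℕ) ∈ omegVertices δ := by simp [omegVertices]
  have m3 : (![δ - 1, 1, 0] : Fin 3 → ℕ) ∈ omegVertices δ := by simp [omegVertices]
  have m4 : (![1, 0, δ - 1] : Fin 3 → ℕ) ∈ omegVertices δ := by simp [omegVertices]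
  have g1 : (![0, 0, 0] : Fin 3 → ℕ) ∈ gamPoints δ := mem_gamPoints.2 (by simp)
  have g2 : (![0, 0, 1] : Fin 3 → ℕ) ∈ gamPoints δ := mem_gamPoints.2 (by simp; omega)
  have g3 : (![δ - 1, 1, 0] : Fin 3 → ℕ) ∈ gamPoints δ := mem_gamPoints.2 (by simp; omega)
  have g4 : (![1, 0, δ - 1] : Fin 3 → ℕ) ∈ gamPoints δ := mem_gamPoints.2 (by simp; omega)
  have hdot : ∀ (d : Fin 3 → ℕ) (p q r : ℝ),
      toReal d ⬝ᵥ ![p, q, r] = d 0 * p + d 1 * q + d 2 * r := by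
    intro d p q r
    simp [dotProduct, Fin.sum_univ_three, toReal]
  have cone : ∀ p q : ℝ, 0 ≤ p → 0 ≤ q → u + ![-p, -q, 0] ∈ (polyOfLift δ α).hypersurface := by
    intro p q hp hq
    refine key _ 0 ![0, 0, 0] ![0, 0, 1] (fun e => by simpa using congrFun e 2) m1 m2 g1 g2 ?_ ?_ ?_
    · intro d _
      rw [hdot]
      have h1 : (0 : ℝ) ≤ d 0 * p := by positivity
      have h2 : (0 : ℝ) ≤ d 1 * q := by positivity
      linarith
    · simp [hdot]
    · simp [hdot]
  intro x hx
  obtain ⟨y, rfl⟩ : ∃ y, x = u + y := ⟨x - u, by simp⟩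
  rw [mem_pencilLine_iff] at hx
  rcases hx with ⟨q, hq, -, rfl⟩ | ⟨s, hs, rfl⟩ | ⟨s, hs, rfl⟩ | ⟨s, hs, rfl⟩ | ⟨s, hs, rfl⟩
  · exact cone _ _ (by positivity) (by positivity)
  · refine key _ 0 ![0, 0, 0] ![δ - 1, 1, 0] (fun e => by simpa using congrFun e 1) m1 m3 g1 g3
      ?_ ?_ ?_
    · intro d _
      rw [hdot]
      have h1 : (0 : ℝ) ≤ d 2 * s := by positivity
      linarith
    · simp [hdot]
    · simp [hdot]
  · refine key _ (δ * s) ![δ - 1, 1, 0] ![1, 0, δ - 1] (fun e => by simpa using congrFun e 1)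
      m3 m4 g3 g4 ?_ ?_ ?_
    · intro d hd
      rw [hdot]
      have h1 : (d 0 : ℝ) + d 1 + d 2 ≤ δ := by exact_mod_cast mem_gamPoints.1 hd
      nlinarith
    · simp [hdot, Nat.cast_sub (Nat.one_le_iff_ne_zero.2 hδ.ne')]
      ring
    · simp [hdot, Nat.cast_sub (Nat.one_le_iff_ne_zero.2 hδ.ne')]
      ring
  · rw [show -t - s = -(t + s) by ring]
    exact cone _ _ (by positivity) ht
  · rw [show -t - s = -(t + s) by ring]
    exact cone _ _ ht (by positivity)

theorem exists_twoPointFamilyOn {δ : ℕ} (hδ : 0 < δ) {𝒯 : Set (Finset (Fin 3 → ℕ))}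
    (hΩ : omegVertices δ ∈ 𝒯) {α : gamPoints δ → ℝ} (hα : IsLiftOf 𝒯 α) :
    ∃ 𝓕 : Set (Set (Fin 3 → ℝ)), IsTwoPointFamilyOn (polyOfLift δ α).hypersurface 𝓕 := by
  obtain ⟨u, c, hu⟩ := hα _ hΩ
  refine ⟨Set.range fun k : ℕ => pencilLine u k, ⟨Set.infinite_range_of_injective
    (pencilLine_injective u), ?_, u + ![0, 0, 0], u + ![0, 0, -1], ?_, ?_⟩, ?_⟩
  · rintro _ ⟨k, rfl⟩
    exact isTropicalLine_pencilLine u (Nat.cast_nonneg k)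
  · intro h
    simpa using congrFun (add_left_cancel h) 2
  · rintro _ ⟨k, rfl⟩
    exact ⟨mem_pencilLine_iff.2 (Or.inr (Or.inl ⟨0, le_rfl, by simp⟩)),
      mem_pencilLine_iff.2 (Or.inr (Or.inl ⟨1, zero_le_one, rfl⟩))⟩
  · rintro _ ⟨k, rfl⟩
    exact pencilLine_subset_hypersurface hδ (fun a => (hu a).1) (fun a => (hu a).2.2)
      (Nat.cast_nonneg k)

end TropicalLines

/-! ### The main theorem: triangulation, secondary cone and two-point family combined -/

theorem mainTheorem3 (δ : ℕ) (hδ : 0 < δ) :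
    (∃ S : Set (Set (Fin 3 → ℝ)),
      TropicalLines.IsRegularSubdivision (TropicalLines.gamPoints δ) S ∧
      TropicalLines.IsElementaryTriangulation (TropicalLines.Gam δ) S ∧
      TropicalLines.Omeg δ ∈ S ∧
      ∃ σ ∈ TropicalLines.secondaryFan (TropicalLines.gamPoints δ),
        TropicalLines.IsPolyhedralCone σ ∧
        (interior σ).Nonempty ∧
        interior σ = TropicalLines.inducingLifts (TropicalLines.gamPoints δ) S ∧
        ∀ α ∈ interior σ,
          TropicalLines.DefinesSmoothSurface δ (TropicalLines.polyOfLift δ α) ∧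
          ∃ 𝓕 : Set (Set (Fin 3 → ℝ)),
            TropicalLines.IsTwoPointFamilyOn (TropicalLines.polyOfLift δ α).hypersurface 𝓕) ∧
    (∃ X : Set (Fin 3 → ℝ), TropicalLines.IsSmoothTropicalSurface δ X ∧
      {L : Set (Fin 3 → ℝ) | TropicalLines.IsTropicalLine L ∧ L ⊆ X}.Infinite) := by
  open TropicalLines in
  obtain ⟨𝒯, h𝒯, hΩ⟩ := exists_cornerTriangulation hδ
  have hcov : IsUnimodularCover (gamPoints δ) 𝒯 := gamPoints_eq δ ▸ h𝒯.isUnimodularCover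
  obtain ⟨g, hg⟩ := h𝒯.regular
  rw [← gamPoints_eq] at hg
  have hα₀ : IsLiftOf 𝒯 fun a : gamPoints δ => g a.1 := by
    intro T hT
    obtain ⟨u, c, hu⟩ := hg T hT
    exact ⟨u, c, fun a => hu a.1 a.2⟩
  have hsmooth : ∀ {α : gamPoints δ → ℝ}, IsLiftOf 𝒯 α →
      DefinesSmoothSurface δ (polyOfLift δ α) := fun hα =>
    ⟨convexHull_gamPoints hδ, convexHull_gamPoints hδ ▸ hcov.isElementaryTriangulation hα⟩
  obtain ⟨H, hH⟩ := hcov.exists_duals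
  have hset : {β : gamPoints δ → ℝ | IsLiftOf 𝒯 β} = {β | ∀ L ∈ H, 0 < L β} := by
    ext β
    exact hH β
  have hint := interior_closedCone H ((hH _).1 hα₀)
  rw [← hset] at hint
  -- The cone is given by the weak inequalities. Because the strict ones have the solution `g`, it
  -- is the closure of the set of lifts and that set is its interior.
  refine ⟨⟨_, ⟨_, rfl⟩, (hsmooth hα₀).2, ?_, {β | ∀ L ∈ H, 0 ≤ L β}, ⟨fun a => g a.1, ?_⟩, ⟨H, rfl⟩,
    ?_, ?_, ?_⟩, ?_⟩
  · exact convexHull_omegVertices hδ ▸ hcov.cell_mem hα₀ hΩ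
  · rw [hcov.setOf_marked_eq hα₀, hset, closure_openCone H ((hH _).1 hα₀)]
  · rw [hint]
    exact ⟨_, hα₀⟩
  · rw [hint]
    exact (hcov.inducingLifts_eq hα₀).symm
  · intro α hα
    rw [hint] at hα
    exact ⟨hsmooth hα, exists_twoPointFamilyOn hδ hΩ hα⟩
  · refine ⟨_, ⟨_, rfl, hsmooth hα₀⟩, ?_⟩
    obtain ⟨𝓕, ⟨hinf, hline, -⟩, hsub⟩ := exists_twoPointFamilyOn hδ hΩ hα₀
    exact hinf.mono fun L hL => ⟨hline L hL, hsub L hL⟩
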